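/- Let $n$ be a natural number, $q=e^h\in\mathbb C[[h]]$, and $\hat m=\frac{1-q^{-2m}}{1-q^{-2}}=1+q^{-2}+\dots+q^{-2(m-1)}$. Let $S$ be the standard Hecke symmetry of $\mathcal U_h(gl(n,\mathbb C))$ on $\mathbb C^n\otimes\mathbb C^n$: $S(e_c\otimes e_c)=q\,e_c\otimes e_c$, $S(e_c\otimes e_d)=e_d\otimes e_c$ for $c>d$, and $S(e_c\otimes e_d)=e_d\otimes e_c+(q-q^{-1})e_c\otimes e_d$ for $c<d$. Let $\mathcal L_h$ be the reflection equation algebra, i.e. the associative unital $\mathbb C[[h]]$-algebra generated by the entries of an $n\times n$ matrix $L$ subject to $SL_2SL_2=L_2SL_2S$, $L_2=1\otimes L$. Let $\mathcal S_h\subset\mathcal L_h$ be its subalgebra of invariants, that is, its center. Put $\mathrm{Tr}_q(A)=\mathrm{Tr}(DA)$ with $D=\mathrm{diag}(1,q^{-2},\dots,q^{-2(n-1)})$, so that $(\mathrm{Tr}_q\otimes\mathrm{id})(S)=q\cdot 1$, and $s_m=\mathrm{Tr}_q(L^m)$ for $m\ge 0$. Then all $s_m$ lie in $\mathcal S_h$,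 and there are elements $\sigma_m\in\mathcal S_h$ ($m\ge0$), with $\sigma_0=1$ and $\sigma_m=0$ for $m>n$, which are the coefficients in the quantum Cayley–Hamilton identity $$L^n-\sigma_1L^{n-1}+\dots+(-1)^n\sigma_n=0$$ and satisfy the quantum Newton identities $\hat m\,\sigma_m-s_1\sigma_{m-1}+\dots+(-1)^ms_m=0$ for all $m\ge1$, such that the following holds. For every $\lambda=(\lambda_1,\dots,\lambda_n)\in\mathbb C^n[[h]]$ and every character (homomorphism of $\mathbb C[[h]]$-algebras) $\chi^\lambda:\mathcal S_h\to\mathbb C[[h]]$ with $$\chi^\lambda(\sigma_m)=\sigma_m(\lambda)=\sum_{i_1<\dots<i_m}\lambda_{i_1}\cdots\lambda_{i_m},\qquad m=1,\dots,n,$$ one has $\chi^\lambda(s_m)=\vartheta_m(q^{-2},\lambda)$ for all $m\ge0$, where $\vartheta_0(q^{-2},\lambda)=\hat n$ and, for $m\ge1$, $$\vartheta_m(q^{-2},\lambda)=\sum_{\ell=1}^{n}(1-q^{-2})^{\ell-1}\sum_{\substack{d_1,\dots,d_\ell\ge1\\ d_1+\dots+d_\ell=m}}\ \sum_{1\le j_1<\dots<j_\ell\le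 n}\lambda_{j_1}^{d_1}\cdots\lambda_{j_\ell}^{d_\ell}.$$ -/

import Mathlib

open scoped Kronecker

noncomputable section

namespace REAlg

/-- The ring `ℂ[[h]]` of formal power series. -/
abbrev Ch : Type := PowerSeries ℂ

/-- The deformation parameter `q = e^h`. -/
def q : Ch := PowerSeries.exp ℂ

/-- `q⁻²`; here `q` is invertible since its constant term is `1`. -/
def qm2 : Ch := (q⁻¹) ^ 2

/-- The quantum integer `(1 - p^m) / (1 - p) = 1 + p + ⋯ + p^(m-1)`, used with `p = q⁻²`. -/
def qInt {A : Type*} [CommRing A] (p : A) (m : ℕ) : A := ∑ i ∈ Finset.range m, p ^ i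

lemma qInt_mul {A : Type*} [CommRing A] (p : A) (m : ℕ) : qInt p m * (1 - p) = 1 - p ^ m :=
  geom_sum_mul_neg p m

/-- The Hecke symmetry `S = P R` on `ℂⁿ ⊗ ℂⁿ` for the vector representation of `U_h(gl(n))`:
`S (e_c ⊗ e_c) = q e_c ⊗ e_c`, `S (e_c ⊗ e_d) = e_d ⊗ e_c` for `c > d`, and
`S (e_c ⊗ e_d) = e_d ⊗ e_c + (q - q⁻¹) e_c ⊗ e_d` for `c < d`. The entry in row `(a, b)` and
column `(c, d)` is the coefficient of `e_a ⊗ e_b` in `S (e_c ⊗ e_d)`. -/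
def heckeS (n : ℕ) : Matrix (Fin n × Fin n) (Fin n × Fin n) Ch :=
  Matrix.of fun r c =>
    if r.1 = c.2 ∧ r.2 = c.1 then (if c.1 = c.2 then q else 1)
    else if r.1 = c.1 ∧ r.2 = c.2 ∧ c.1 < c.2 then q - q⁻¹
    else 0

lemma q_mul_qm2 : q * qm2 = q⁻¹ := by
  have h : q * q⁻¹ = 1 := PowerSeries.mul_inv_cancel q (by simp [q])
  rw [qm2, pow_two, ← mul_assoc, h, one_mul]

/-- The normalization `∑_a D_a S^{ab}_{ad} = q δ_{bd}` for `D_a = q^(-2a)`, `a = 0, …, n - 1`. -/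
lemma heckeS_partial_trace (n : ℕ) (b d : Fin n) :
    ∑ a : Fin n, qm2 ^ (a : ℕ) * heckeS n (a, b) (a, d) = if b = d then q else 0 := by
  by_cases h : b = d
  · subst h
    have key : ∀ a : Fin n, qm2 ^ (a : ℕ) * heckeS n (a, b) (a, b) =
        (fun i : ℕ => if i = (b : ℕ) then q * qm2 ^ i else
          if i < b then q * (1 - qm2) * qm2 ^ i else 0) a := by
      intro a
      have e := q_mul_qm2
      simp only [heckeS, Matrix.of_apply, Fin.ext_iff, Fin.lt_def, true_and]
      split_ifs <;> first | omega | (rw [← e]; ring) | ring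
    have hb : (b : ℕ) + 1 ≤ n := b.2
    rw [Finset.sum_congr rfl fun a _ => key a, Fin.sum_univ_eq_sum_range (fun i : ℕ =>
      if i = (b : ℕ) then q * qm2 ^ i else if i < b then q * (1 - qm2) * qm2 ^ i else 0), if_pos rfl,
      ← Finset.sum_subset (Finset.range_mono hb), Finset.sum_range_succ,
      Finset.sum_congr rfl (g := fun i => q * (1 - qm2) * qm2 ^ i), ← Finset.mul_sum]
    · have g := qInt_mul qm2 b
      rw [qInt] at g
      simp only [if_true]
      linear_combination q * g
    · intro i hi
      have := Finset.mem_range.1 hi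
      simp [this, this.ne]
    · intro i _ hi
      have : ¬ i < b + 1 := fun t => hi (Finset.mem_range.2 t)
      rw [if_neg (by omega), if_neg (by omega)]
  · rw [if_neg h]
    refine Finset.sum_eq_zero fun a _ => ?_
    simp only [heckeS, Matrix.of_apply]
    rw [if_neg (by rintro ⟨rfl, rfl⟩; exact h rfl), if_neg (fun t => h t.2.1), mul_zero]

/-- The matrix of free generators. -/
def freeL (n : ℕ) : Matrix (Fin n) (Fin n) (FreeAlgebra Ch (Fin n × Fin n)) :=
  Matrix.of fun i j => FreeAlgebra.ι Ch (i, j)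

/-- `L₂ = 1 ⊗ L` in the free algebra. -/
def freeL₂ (n : ℕ) :
    Matrix (Fin n × Fin n) (Fin n × Fin n) (FreeAlgebra Ch (Fin n × Fin n)) :=
  (1 : Matrix (Fin n) (Fin n) (FreeAlgebra Ch (Fin n × Fin n))) ⊗ₖ freeL n

/-- `S` with its entries regarded as scalars of the free algebra. -/
def freeS (n : ℕ) :
    Matrix (Fin n × Fin n) (Fin n × Fin n) (FreeAlgebra Ch (Fin n × Fin n)) :=
  (heckeS n).map (algebraMap Ch (FreeAlgebra Ch (Fin n × Fin n)))

/-- The entries of the reflection equation `S L₂ S L₂ = L₂ S L₂ S`. -/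
inductive Rel (n : ℕ) :
    FreeAlgebra Ch (Fin n × Fin n) → FreeAlgebra Ch (Fin n × Fin n) → Prop
  | entry (r c : Fin n × Fin n) :
      Rel n ((freeS n * freeL₂ n * freeS n * freeL₂ n) r c)
        ((freeL₂ n * freeS n * freeL₂ n * freeS n) r c)

/-- The quadratic reflection equation algebra over `ℂ[[h]]`. -/
abbrev RE (n : ℕ) : Type := RingQuot (Rel n)

/-- The generating matrix `L` of the reflection equation algebra. -/
def L (n : ℕ) : Matrix (Fin n) (Fin n) (RE n) :=
  (freeL n).map (RingQuot.mkAlgHom Ch (Rel n))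

/-- The quantum trace `Tr_q(A) = Tr(D A)` with `D = diag(1, q⁻², …, q^(-2(n-1)))`, which is the
weight matrix normalized by `(Tr_q ⊗ id)(S) = q · 1` (see `heckeS_partial_trace`). -/
def qTrace (n : ℕ) {A : Type*} [Ring A] [Algebra Ch A] (M : Matrix (Fin n) (Fin n) A) : A :=
  ∑ i : Fin n, (qm2 ^ (i : ℕ)) • M i i

/-- The subalgebra of invariants of the reflection equation algebra, that is, its center. -/
abbrev Inv (n : ℕ) : Subalgebra Ch (RE n) := Subalgebra.center Ch (RE n)

/-- `ϑ_m(p, λ)` for `λ = (λ_1, …, λ_n)`, used with `p = q⁻²`: it is `1 + p + ⋯ + p^(n-1)` for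
`m = 0`, and for `m > 0` the sum over `1 ≤ ℓ ≤ n` of `(1 - p)^(ℓ-1)` times the sum of
`λ_{j_1}^{d_1} ⋯ λ_{j_ℓ}^{d_ℓ}` over `ℓ`-tuples of positive integers `d` with sum `m` and over
`j_1 < ⋯ < j_ℓ`. -/
def vartheta {A : Type*} [CommRing A] (n : ℕ) (p : A) (lam : Fin n → A) (m : ℕ) : A :=
  if m = 0 then qInt p n
  else ∑ l ∈ Finset.Icc 1 n, (1 - p) ^ (l - 1) *
    ∑ d ∈ (Finset.finAntidiagonal l m).filter (fun d => ∀ a, 0 < d a),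
      ∑ j ∈ (Finset.univ : Finset (Fin l → Fin n)).filter (fun j => ∀ a b, a < b → j a < j b),
        ∏ a : Fin l, lam (j a) ^ d a

end REAlg

end

/-!
The coefficients `σ_m` are defined from the power sums `s_m` by the Newton identities, which is
possible because the quantum integers are invertible in `ℂ[[h]]`. The argument has three parts.

*Centrality.* Write `L` for the generating matrix, acting on the factor `0` of a tensor power, and
`S` for the Hecke symmetry of the factors `1` and `0`. The reflection equation gives
`L S L^m S⁻¹ = S⁻¹ L^m S L`; as conjugation by `S` turns the `q`-trace over one factor into the
`q`-trace over the other, the `q`-trace over the factor `1` of this identity is `L s_m = s_m L`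
(`IsReflectionTower.commute_partialTrace_pow`).

*Cayley-Hamilton.* Put `B_0 = 1` and `B_{k+1} = σ_{k+1} - L B_k`, so that `B_n` is the
Cayley-Hamilton expression and the Newton identities read `Tr_q (L B_k) = (k+1)^ σ_{k+1}`, where
`k^` is the quantum integer. Let `X_0 = L`, `X_{i+1} = S_i X_i S_i⁻¹`, and let `A` be the
`q`-antisymmetrizer of the factors `0, …, k`. Then `k^! B_k` is the `q`-trace over the factors
`1, …, k` of `X_1 ⋯ X_k A` (`IsReflectionTower.iterTrace_step`): factor `A` as the antisymmetrizer
of the last `k` factors times a sum over coset representatives, and use the cyclicity of the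
`q`-trace together with the fact that `S_j` commutes with `X_i X_{i+1} ⋯ X_{i+k}` for
`i ≤ j < i + k`. For `k = n` the antisymmetrizer of `n + 1` factors vanishes
(`eq_zero_of_heckeOp_eq`), hence `B_n = 0`. Taking `q`-traces of `L B_m`, one gets `σ_m = 0` for
all `m > n`.

All operators act on functions `(ℕ → Fin n) → RE n` of infinite words with values in the reflection
equation algebra, so that all tensor powers live in one ring, and there the relations between the
Hecke symmetries become identities between permuted words. The matrices over the algebra embed
into this ring (`matrixOp_injective`).

*Characters.* The Newton identities determine the power sums by the elementary symmetric functions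
(`eq_of_newton`), so it is enough that the functions `ϑ_m` satisfy them (`newton_vartheta`). This
is the identity
`∏_j (1 + ∑_{d ≥ 1} (1 - p) λ_j^d x^d) * ∏_j (1 - λ_j x) = ∏_j (1 - p λ_j x)` of power series.
-/

namespace REAlg

/-! ### Hecke generators and antisymmetrizers -/

section Hecke

variable {K M : Type*} [CommRing K] [Ring M] [Algebra K M]

/-- The relations of the generators of the infinite Hecke algebra, with eigenvalues `q` and `-t`,
where `t = q⁻¹`. -/
structure IsHeckeFamily (q t : K) (S : ℕ → M) : Prop where
  qt : q * t = 1
  quad : ∀ i, S i * S i = 1 + (q - t) • S i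
  braid : ∀ i, S i * S (i + 1) * S i = S (i + 1) * S i * S (i + 1)
  far : ∀ i j, i + 2 ≤ j → S i * S j = S j * S i

/-- `1 - t S_i + t² S_i S_{i+1} - ⋯ ± t^k S_i ⋯ S_{i+k-1}`, the alternating sum over minimal coset
representatives. -/
def cosetSum (t : K) (S : ℕ → M) : ℕ → ℕ → M
  | _, 0 => 1
  | i, k + 1 => 1 - t • (S i * cosetSum t S (i + 1) k)

/-- The (unnormalized) `q`-antisymmetrizer on the positions `i, …, i + k`, an element of the algebra
generated by `S_i, …, S_{i+k-1}`. -/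
def antisym (t : K) (S : ℕ → M) : ℕ → ℕ → M
  | _, 0 => 1
  | i, k + 1 => antisym t S (i + 1) k * cosetSum t S i (k + 1)

/-- The quantum factorial, with respect to the quantum integers `qInt p`. -/
def qFac (p : K) (k : ℕ) : K := ∏ j ∈ Finset.range k, qInt p (j + 1)

lemma qFac_succ (p : K) (k : ℕ) : qFac p (k + 1) = qFac p k * qInt p (k + 1) :=
  Finset.prod_range_succ _ _

lemma isUnit_qFac {p : K} (hu : ∀ k, IsUnit (qInt p (k + 1))) (k : ℕ) : IsUnit (qFac p k) :=
  Finset.prod_induction _ IsUnit (fun _ _ => IsUnit.mul) isUnit_one fun j _ => hu j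

lemma qInt_succ' (p : K) (k : ℕ) : qInt p (k + 1) = 1 + p * qInt p k := by
  rw [qInt, qInt, Finset.sum_range_succ', Finset.mul_sum, add_comm]
  simp [pow_succ']

lemma commute_cosetSum (t : K) (S : ℕ → M) {y : M} :
    ∀ (k i : ℕ), (∀ j, i ≤ j → j < i + k → Commute y (S j)) → Commute y (cosetSum t S i k)
  | 0, _, _ => Commute.one_right y
  | k + 1, i, h => by
    rw [cosetSum]
    exact (Commute.one_right y).sub_right (((h i le_rfl (by omega)).mul_right
      (commute_cosetSum t S k (i + 1) fun j h1 h2 => h j (by omega) (by omega))).smul_right t)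

namespace IsHeckeFamily

variable {q t : K} {S : ℕ → M}

lemma op (h : IsHeckeFamily q t S) :
    IsHeckeFamily q t (fun i => MulOpposite.op (S i)) where
  qt := h.qt
  quad i := by rw [← MulOpposite.op_mul, h.quad]; rfl
  braid i := by
    simp only [← MulOpposite.op_mul]
    rw [← mul_assoc, h.braid, mul_assoc]
  far i j hij := by simp only [← MulOpposite.op_mul, h.far i j hij]

lemma commute (h : IsHeckeFamily q t S) {i j : ℕ} (hij : i + 2 ≤ j) : Commute (S i) (S j) :=
  h.far i j hij

/-- If `A` absorbs `S_{i+1}, …, S_{i+k}` on the right with eigenvalue `-t`, then its product with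
the sum over coset representatives absorbs `S_i` as well. The induction replaces `A` by `A S_i`. -/
lemma mul_cosetSum_mul (h : IsHeckeFamily q t S) : ∀ (k i : ℕ) (A : M),
    (∀ l, i < l → l ≤ i + k → A * S l = -t • A) → ∀ j, i ≤ j → j ≤ i + k →
      A * cosetSum t S i (k + 1) * S j = -t • (A * cosetSum t S i (k + 1)) := by
  have hq := h.qt
  intro k
  induction k with
  | zero =>
    intro i A _ j h1 h2
    obtain rfl : j = i := by omega
    simp only [cosetSum, mul_one, mul_sub, sub_mul, mul_smul_comm, smul_mul_assoc, mul_assoc,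
      h.quad, mul_add]
    linear_combination (norm := module) -hq • (A * S j)
  | succ k ih =>
    intro i A hA j h1 h2
    rcases h1.eq_or_lt with rfl | h1
    · have e1 : Commute (cosetSum t S (i + 2) k) (S i) :=
        (commute_cosetSum t S k (i + 2) fun j h1 h2 => h.commute (by omega)).symm
      have e2 : A * (S i * (S (i + 1) * (S i * cosetSum t S (i + 2) k))) =
          -t • (A * (S i * (S (i + 1) * cosetSum t S (i + 2) k))) := by
        have := h.braid i
        rw [← mul_assoc (S (i + 1)), ← mul_assoc (S i), ← mul_assoc (S i), this, ← mul_assoc A,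
          ← mul_assoc A, ← mul_assoc A, hA _ (by omega) (by omega)]
        simp only [smul_mul_assoc, mul_assoc]
      rw [cosetSum, cosetSum]
      simp only [mul_one, mul_sub, sub_mul, mul_smul_comm, smul_mul_assoc, mul_assoc,
        h.quad, mul_add, e1.eq, e2]
      linear_combination (norm := module) -hq • (A * S i)
    · have := ih (i + 1) (A * S i) (fun l hl1 hl2 => by
        rw [mul_assoc, h.far i l (by omega), ← mul_assoc, hA l (by omega) (by omega),
          smul_mul_assoc]) j (by omega) (by omega)
      rw [cosetSum, mul_sub, sub_mul, mul_one, hA j h1 (by omega), mul_smul_comm, smul_mul_assoc,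
        ← mul_assoc A, this]
      module

lemma antisym_mul (h : IsHeckeFamily q t S) : ∀ (k i j : ℕ), i ≤ j → j < i + k →
    antisym t S i k * S j = -t • antisym t S i k
  | 0, _, _, _, _ => by omega
  | k + 1, i, j, h1, h2 => by
    rw [antisym]
    exact h.mul_cosetSum_mul k i _
      (fun l _ _ => antisym_mul h k (i + 1) l (by omega) (by omega)) j h1 (by omega)

/-- Evaluating `cosetSum` in the sign character of the Hecke algebra gives a quantum integer. -/
lemma cosetSum_mul_of_absorb {A : M} : ∀ (k i : ℕ),
    (∀ l, i ≤ l → l < i + k → S l * A = -t • A) →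
    cosetSum t S i k * A = qInt (t ^ 2) (k + 1) • A
  | 0, _, _ => by simp [cosetSum, qInt]
  | k + 1, i, hA => by
    rw [cosetSum, sub_mul, one_mul, smul_mul_assoc, mul_assoc,
      cosetSum_mul_of_absorb k (i + 1) fun l _ _ => hA l (by omega) (by omega), mul_smul_comm,
      hA i le_rfl (by omega), qInt_succ' _ (k + 1)]
    module

/-- Evaluating `antisym` in the sign character gives a quantum factorial. -/
lemma antisym_mul_of_absorb {A : M} : ∀ (k i : ℕ),
    (∀ l, i ≤ l → l < i + k → S l * A = -t • A) →
    antisym t S i k * A = qFac (t ^ 2) (k + 1) • A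
  | 0, _, _ => by simp [antisym, qFac, qInt]
  | k + 1, i, hA => by
    rw [antisym, mul_assoc, cosetSum_mul_of_absorb (k + 1) i hA, mul_smul_comm,
      antisym_mul_of_absorb k (i + 1) fun l _ _ => hA l (by omega) (by omega), qFac_succ _ (k + 1),
      smul_smul, mul_comm]

/-- The antisymmetrizer equals its mirror image, since the two absorb one another; hence it
absorbs the generators on the left as well. -/
lemma mul_antisym (h : IsHeckeFamily q t S) (hu : ∀ k, IsUnit (qInt (t ^ 2) (k + 1)))
    (k i j : ℕ) (h1 : i ≤ j) (h2 : j < i + k) : S j * antisym t S i k = -t • antisym t S i k := by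
  obtain ⟨A', hA'⟩ : ∃ A', A' = (antisym t (fun i => MulOpposite.op (S i)) i k).unop := ⟨_, rfl⟩
  have left : ∀ l, i ≤ l → l < i + k → S l * A' = -t • A' := fun l h1 h2 => by
    have := congrArg MulOpposite.unop (h.op.antisym_mul k i l h1 h2)
    simpa [hA'] using this
  have e1 : antisym t S i k * A' = qFac (t ^ 2) (k + 1) • A' := antisym_mul_of_absorb k i left
  have e2 : antisym t S i k * A' = qFac (t ^ 2) (k + 1) • antisym t S i k := by
    have := antisym_mul_of_absorb (S := fun i => MulOpposite.op (S i)) (t := t)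
      (A := MulOpposite.op (antisym t S i k)) k i (fun l h1 h2 => by
        rw [← MulOpposite.op_mul, h.antisym_mul k i l h1 h2]; rfl)
    simpa [hA'] using congrArg MulOpposite.unop this
  have : antisym t S i k = A' := (isUnit_qFac hu (k + 1)).smul_left_cancel.1 (e2.symm.trans e1)
  rw [this]
  exact left j h1 h2

end IsHeckeFamily

end Hecke

/-! ### Matrix units, partial `q`-traces and the Hecke symmetry -/

section MatrixUnits

variable {n : ℕ} {K M : Type*} [CommRing K] [Ring M] [Algebra K M]

/-- Commuting systems of `n × n` matrix units, `e j` being the system attached to the `j`-th tensor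
factor. -/
structure IsMatrixUnits (e : ℕ → Fin n → Fin n → M) : Prop where
  mul : ∀ j a b c d, e j a b * e j c d = if b = c then e j a d else 0
  comm : ∀ i j, i ≠ j → ∀ a b c d, Commute (e i a b) (e j c d)
  one : ∀ j, ∑ a, e j a a = 1

/-- The partial `q`-trace over the `j`-th tensor factor, with weights `t^(2a)`. -/
def partialTrace (t : K) (e : ℕ → Fin n → Fin n → M) (j : ℕ) : M →ₗ[K] M :=
  ∑ a : Fin n, (t ^ 2) ^ (a : ℕ) • ∑ b, LinearMap.mulLeftRight K (e j b a, e j a b)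

lemma partialTrace_apply (t : K) (e : ℕ → Fin n → Fin n → M) (j : ℕ) (Y : M) :
    partialTrace t e j Y = ∑ a : Fin n, (t ^ 2) ^ (a : ℕ) • ∑ b, e j b a * Y * e j a b := by
  simp [partialTrace, LinearMap.sum_apply]

/-- The Hecke symmetry acting on the tensor factors `i + 1` and `i`, in this order. -/
def heckeOp (q t : K) (e : ℕ → Fin n → Fin n → M) (i : ℕ) : M :=
  ∑ a : Fin n, ∑ c : Fin n, ((if a = c then q else 1) • (e i a c * e (i + 1) c a) +
    (if c < a then q - t else 0) • (e i a a * e (i + 1) c c))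

/-- `Y` acts trivially on the `j`-th tensor factor, that is, it commutes with the matrix units of
that factor. -/
def CommutesAt (e : ℕ → Fin n → Fin n → M) (j : ℕ) (Y : M) : Prop :=
  ∀ a b, Commute (e j a b) Y

namespace CommutesAt

variable {e : ℕ → Fin n → Fin n → M} {j : ℕ} {X Y : M}

lemma mul (hX : CommutesAt e j X) (hY : CommutesAt e j Y) : CommutesAt e j (X * Y) :=
  fun a b => (hX a b).mul_right (hY a b)

lemma add (hX : CommutesAt e j X) (hY : CommutesAt e j Y) : CommutesAt e j (X + Y) :=
  fun a b => (hX a b).add_right (hY a b)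

lemma sub (hX : CommutesAt e j X) (hY : CommutesAt e j Y) : CommutesAt e j (X - Y) :=
  fun a b => (hX a b).sub_right (hY a b)

lemma smul (r : K) (hX : CommutesAt e j X) : CommutesAt e j (r • X) :=
  fun a b => (hX a b).smul_right r

lemma one : CommutesAt e j 1 := fun _ _ => Commute.one_right _

lemma pow (hX : CommutesAt e j X) (m : ℕ) : CommutesAt e j (X ^ m) :=
  fun a b => (hX a b).pow_right m

lemma sum {ι : Type*} {s : Finset ι} {f : ι → M} (h : ∀ x ∈ s, CommutesAt e j (f x)) :
    CommutesAt e j (∑ x ∈ s, f x) :=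
  fun a b => Commute.sum_right _ _ _ fun x hx => h x hx a b

lemma partialTrace_mul (t : K) (hX : CommutesAt e j X) (Y : M) :
    partialTrace t e j (X * Y) = X * partialTrace t e j Y := by
  simp only [partialTrace_apply, Finset.mul_sum, mul_smul_comm]
  refine Finset.sum_congr rfl fun a _ => congrArg _ (Finset.sum_congr rfl fun b _ => ?_)
  rw [← mul_assoc, (hX b a).eq]
  simp only [mul_assoc]

lemma partialTrace_mul' (t : K) (hX : CommutesAt e j X) (Y : M) :
    partialTrace t e j (Y * X) = partialTrace t e j Y * X := by
  simp only [partialTrace_apply, Finset.sum_mul, smul_mul_assoc]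
  refine Finset.sum_congr rfl fun a _ => congrArg _ (Finset.sum_congr rfl fun b _ => ?_)
  simp only [mul_assoc, (hX a b).eq]

end CommutesAt

lemma sum_ite_pow (p A B : K) (c : Fin n) :
    ∑ x : Fin n, p ^ (x : ℕ) * (if x = c then A else if x < c then B else 0) =
      A * p ^ (c : ℕ) + B * qInt p c := by
  have key : ∀ x : Fin n, p ^ (x : ℕ) * (if x = c then A else if x < c then B else 0) =
      (fun i : ℕ => if i = (c : ℕ) then A * p ^ i else if i < c then B * p ^ i else 0) x := by
    intro x
    simp only [Fin.ext_iff, Fin.lt_def]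
    split_ifs <;> ring
  rw [Finset.sum_congr rfl fun x _ => key x, Fin.sum_univ_eq_sum_range (fun i : ℕ =>
    if i = (c : ℕ) then A * p ^ i else if i < c then B * p ^ i else 0),
    ← Finset.sum_subset (Finset.range_mono (show (c : ℕ) + 1 ≤ n from c.2)), Finset.sum_range_succ,
    Finset.sum_congr rfl (g := fun i => B * p ^ i), ← Finset.mul_sum, if_pos rfl, qInt, add_comm]
  · intro i hi
    have := Finset.mem_range.1 hi
    simp [this, this.ne]
  · intro i _ hi
    have : ¬ i < c + 1 := fun t => hi (Finset.mem_range.2 t)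
    rw [if_neg (by omega), if_neg (by omega)]

namespace IsMatrixUnits

variable {e : ℕ → Fin n → Fin n → M}

lemma commutesAt_heckeOp (he : IsMatrixUnits e) (q t : K) {i j : ℕ} (h1 : j ≠ i) (h2 : j ≠ i + 1) :
    CommutesAt e j (heckeOp q t e i) := by
  have h (i') (hi : j ≠ i') (a b) : CommutesAt e j (e i' a b) := fun c d => he.comm j i' hi _ _ _ _
  exact .sum fun a _ => .sum fun c _ =>
    (((h _ h1 _ _).mul (h _ h2 _ _)).smul _).add (((h _ h1 _ _).mul (h _ h2 _ _)).smul _)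

lemma commute_heckeOp {q t : K} {i : ℕ} {Y : M} (h1 : CommutesAt e i Y)
    (h2 : CommutesAt e (i + 1) Y) : Commute (heckeOp q t e i) Y := by
  refine Commute.sum_left _ _ _ fun a _ => Commute.sum_left _ _ _ fun c _ => Commute.add_left ?_ ?_
  · exact ((h1 _ _).mul_left (h2 _ _)).smul_left _
  · exact ((h1 _ _).mul_left (h2 _ _)).smul_left _

lemma commute_heckeOp_heckeOp (he : IsMatrixUnits e) (q t : K) {i j : ℕ} (h : i + 2 ≤ j) :
    Commute (heckeOp q t e i) (heckeOp q t e j) :=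
  commute_heckeOp (he.commutesAt_heckeOp q t (by omega) (by omega))
    (he.commutesAt_heckeOp q t (by omega) (by omega))

lemma partialTrace_unit_mul (he : IsMatrixUnits e) (t : K) (j : ℕ) (x y : Fin n) (Y : M) :
    partialTrace t e j (e j x y * Y) = (t ^ 2) ^ (x : ℕ) • ∑ b, e j b y * Y * e j x b := by
  rw [partialTrace_apply, Finset.sum_eq_single x]
  · simp only [← mul_assoc, he.mul, if_true]
  · intro a _ ha
    simp only [← mul_assoc, he.mul, if_neg ha, zero_mul, Finset.sum_const_zero, smul_zero]
  · simp

lemma partialTrace_mul_unit (he : IsMatrixUnits e) (t : K) (j : ℕ) (x y : Fin n) (Y : M) :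
    partialTrace t e j (Y * e j x y) = (t ^ 2) ^ (y : ℕ) • ∑ b, e j b y * Y * e j x b := by
  rw [partialTrace_apply, Finset.sum_eq_single y]
  · simp only [mul_assoc, he.mul, if_true]
  · intro a _ ha
    simp only [mul_assoc, he.mul, if_neg ha.symm, mul_zero, Finset.sum_const_zero, smul_zero]
  · simp

lemma partialTrace_unit (he : IsMatrixUnits e) (t : K) (j : ℕ) (x y : Fin n) :
    partialTrace t e j (e j x y) = if x = y then algebraMap K M ((t ^ 2) ^ (x : ℕ)) else 0 := by
  have := he.partialTrace_unit_mul t j x y 1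
  rw [mul_one] at this
  rw [this]
  simp only [mul_one, he.mul]
  split_ifs with h1 h2 h2
  · rw [he.one, Algebra.algebraMap_eq_smul_one]
  · exact absurd h1.symm h2
  · exact absurd h2.symm h1
  · simp

/-- Cyclicity of the double `q`-trace with respect to the Hecke symmetry, which holds because the
weights are constant on each pair of letters that it exchanges. -/
lemma partialTrace_partialTrace_comm (he : IsMatrixUnits e) (q t : K) (i : ℕ) (Y : M) :
    partialTrace t e i (partialTrace t e (i + 1) (heckeOp q t e i * Y)) =
      partialTrace t e i (partialTrace t e (i + 1) (Y * heckeOp q t e i)) := by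
  have key : ∀ x y u v : Fin n, (x : ℕ) + u = y + v →
      partialTrace t e i (partialTrace t e (i + 1) (e i x y * e (i + 1) u v * Y)) =
      partialTrace t e i (partialTrace t e (i + 1) (Y * (e i x y * e (i + 1) u v))) := by
    intro x y u v h
    have hc : CommutesAt e (i + 1) (e i x y) := fun _ _ => he.comm _ _ (by omega) _ _ _ _
    rw [mul_assoc, hc.partialTrace_mul, he.partialTrace_unit_mul, he.partialTrace_unit_mul,
      (he.comm i (i + 1) (by omega) x y u v).eq, ← mul_assoc, hc.partialTrace_mul',
      he.partialTrace_mul_unit, he.partialTrace_mul_unit]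
    simp only [mul_smul_comm, smul_mul_assoc, ← Finset.smul_sum, smul_smul, ← pow_add, h]
  simp only [heckeOp, Finset.sum_mul, Finset.mul_sum, map_sum, add_mul, mul_add, map_add,
    smul_mul_assoc, mul_smul_comm, map_smul]
  refine Finset.sum_congr rfl fun a _ => Finset.sum_congr rfl fun c _ => ?_
  rw [key _ _ _ _ (add_comm _ _), key _ _ _ _ rfl]

/-- The coefficient, in the `i`-th tensor factor, of the matrix unit `e (i + 1) x y` in the Hecke
symmetry. -/
def heckeCoeff (q t : K) (e : ℕ → Fin n → Fin n → M) (i : ℕ) (x y : Fin n) : M :=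
  if x = y then ∑ c : Fin n, (if c = x then q else if x < c then q - t else 0) • e i c c
  else e i y x

lemma heckeOp_eq_sum_coeff (q t : K) (i : ℕ) :
    heckeOp q t e i = ∑ x, ∑ y, heckeCoeff q t e i x y * e (i + 1) x y := by
  have h1 : ∀ x y : Fin n, heckeCoeff q t e i x y * e (i + 1) x y =
      (if y = x then q else 1 : K) • (e i y x * e (i + 1) x y) +
        if x = y then ∑ c : Fin n, (if x < c then q - t else 0 : K) • (e i c c * e (i + 1) x x)
          else 0 := by
    intro x y
    rcases eq_or_ne x y with rfl | h
    · simp only [heckeCoeff, if_true, Finset.sum_mul, smul_mul_assoc]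
      have : (q • (e i x x * e (i + 1) x x)) =
          ∑ c, if c = x then q • (e i c c * e (i + 1) x x) else 0 := by simp
      rw [this, ← Finset.sum_add_distrib]
      refine Finset.sum_congr rfl fun c _ => ?_
      rcases eq_or_ne c x with rfl | hc
      · simp
      · simp [hc]
    · simp [heckeCoeff, h, h.symm]
  simp only [h1, heckeOp, Finset.sum_add_distrib, Finset.sum_ite_eq, Finset.mem_univ, if_true]
  congr 1
  · rw [Finset.sum_comm]
  · rw [Finset.sum_comm]

lemma commutesAt_heckeCoeff (he : IsMatrixUnits e) (q t : K) (i : ℕ) (x y : Fin n) :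
    CommutesAt e (i + 1) (heckeCoeff q t e i x y) := by
  have h (a b) : CommutesAt e (i + 1) (e i a b) := fun c d => he.comm _ _ (by omega) _ _ _ _
  rw [heckeCoeff]
  split_ifs
  · exact .sum fun c _ => (h _ _).smul _
  · exact h _ _

/-- `(id ⊗ Tr_q) S = q`. -/
lemma partialTrace_heckeOp (he : IsMatrixUnits e) {q t : K} (hqt : q * t = 1) (i : ℕ) :
    partialTrace t e (i + 1) (heckeOp q t e i) = algebraMap K M q := by
  have h1 : ∀ x y, partialTrace t e (i + 1) (heckeCoeff q t e i x y * e (i + 1) x y) =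
      if x = y then (t ^ 2) ^ (x : ℕ) • heckeCoeff q t e i x y else 0 := by
    intro x y
    rw [(he.commutesAt_heckeCoeff q t i x y).partialTrace_mul, he.partialTrace_unit]
    split_ifs
    · rw [← Algebra.commutes, Algebra.smul_def]
    · simp
  simp only [heckeOp_eq_sum_coeff, map_sum, h1, Finset.sum_ite_eq, Finset.mem_univ, if_true]
  simp only [heckeCoeff, if_true, Finset.smul_sum, smul_smul]
  rw [Finset.sum_comm]
  simp only [← Finset.sum_smul]
  have h2 : ∀ c : Fin n, ∑ x : Fin n, (t ^ 2) ^ (x : ℕ) *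
      (if c = x then q else if x < c then q - t else 0) = q := by
    intro c
    simp only [eq_comm (a := c)]
    rw [sum_ite_pow]
    linear_combination q * qInt_mul (t ^ 2) c + qInt (t ^ 2) c * t * hqt
  simp only [h2, ← Finset.smul_sum, he.one, Algebra.algebraMap_eq_smul_one]

/-- The partial `q`-trace of `S Y S`. The coefficient of each `e_cc Y e_dd` in the correction term
is a geometric sum and does not depend on `c` and `d`, which is due to the choice of the weights of
the `q`-trace. -/
lemma partialTrace_heckeOp_mul_mul (he : IsMatrixUnits e) {q t : K} (hqt : q * t = 1) (i : ℕ)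
    {Y : M} (hY : CommutesAt e (i + 1) Y) :
    partialTrace t e (i + 1) (heckeOp q t e i * Y * heckeOp q t e i) =
      partialTrace t e i Y + ((q - t) * q) • Y := by
  have h1 : ∀ x y u v, partialTrace t e (i + 1) (heckeCoeff q t e i x y * e (i + 1) x y * Y *
        (heckeCoeff q t e i u v * e (i + 1) u v)) =
      if y = u then if x = v then (t ^ 2) ^ (x : ℕ) • (heckeCoeff q t e i x y * Y *
        heckeCoeff q t e i u v) else 0 else 0 := by
    intro x y u v
    have c1 := he.commutesAt_heckeCoeff q t i x y
    have c2 := he.commutesAt_heckeCoeff q t i u v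
    have : heckeCoeff q t e i x y * e (i + 1) x y * Y * (heckeCoeff q t e i u v * e (i + 1) u v) =
        heckeCoeff q t e i x y * Y * heckeCoeff q t e i u v * (e (i + 1) x y * e (i + 1) u v) := by
      have e1 := ((hY.mul c2) x y).eq
      calc _ = heckeCoeff q t e i x y * (e (i + 1) x y * (Y * heckeCoeff q t e i u v)) *
            e (i + 1) u v := by simp only [mul_assoc]
        _ = _ := by rw [e1]; simp only [mul_assoc]
    rw [this, ((c1.mul hY).mul c2).partialTrace_mul, he.mul]
    split_ifs with h1 h2
    · rw [he.partialTrace_unit, if_pos h2, ← Algebra.commutes, Algebra.smul_def]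
    · rw [he.partialTrace_unit, if_neg h2, mul_zero]
    · simp
  have h2 : partialTrace t e (i + 1) (heckeOp q t e i * Y * heckeOp q t e i) =
      ∑ x : Fin n, ∑ y, (t ^ 2) ^ (x : ℕ) •
        (heckeCoeff q t e i x y * Y * heckeCoeff q t e i y x) := by
    simp only [heckeOp_eq_sum_coeff, Finset.sum_mul, Finset.mul_sum, map_sum, h1,
      Finset.sum_ite_eq', Finset.mem_univ, if_true]
    exact Finset.sum_comm
  -- Compare with `∑ D_x e_yx Y e_xy`, the partial trace over the other factor: only the diagonal
  -- coefficients of `S` contribute to the difference.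
  have h3 : ∀ x y : Fin n, (t ^ 2) ^ (x : ℕ) •
        (heckeCoeff q t e i x y * Y * heckeCoeff q t e i y x) =
      (t ^ 2) ^ (x : ℕ) • (e i y x * Y * e i x y) + if x = y then
        ∑ c : Fin n, ∑ d : Fin n, ((t ^ 2) ^ (x : ℕ) *
          ((if c = x then q else if x < c then q - t else 0) *
          (if d = x then q else if x < d then q - t else 0) - if c = x then if d = x then 1 else 0
            else 0)) • (e i c c * Y * e i d d) else 0 := by
    intro x y
    rcases eq_or_ne x y with rfl | h
    · simp only [heckeCoeff, if_true, Finset.sum_mul, Finset.mul_sum, smul_mul_assoc,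
        mul_smul_comm, smul_smul, Finset.smul_sum]
      have : ((t ^ 2) ^ (x : ℕ)) • (e i x x * Y * e i x x) = ∑ c : Fin n, ∑ d : Fin n,
          ((t ^ 2) ^ (x : ℕ) * if c = x then if d = x then 1 else 0 else 0) •
            (e i c c * Y * e i d d) := by
        simp
      rw [this, ← Finset.sum_add_distrib, Finset.sum_comm]
      refine Finset.sum_congr rfl fun c _ => ?_
      rw [← Finset.sum_add_distrib]
      refine Finset.sum_congr rfl fun d _ => ?_
      module
    · simp [heckeCoeff, h, h.symm]
  have h4 : ∀ c d : Fin n, ∑ x : Fin n, (t ^ 2) ^ (x : ℕ) *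
          ((if c = x then q else if x < c then q - t else 0) *
          (if d = x then q else if x < d then q - t else 0) - if c = x then if d = x then 1 else 0
            else 0) = (q - t) * q := by
    have h5 : ∀ c : Fin n, (q * (q - t)) * (t ^ 2) ^ (c : ℕ) + (q - t) ^ 2 * qInt (t ^ 2) c =
        (q - t) * q := by
      intro c
      linear_combination (q - t) * q * qInt_mul (t ^ 2) c +
        (q - t) * qInt (t ^ 2) c * t * hqt
    have h6 : ∀ c d : Fin n, c ≤ d → ∑ x : Fin n, (t ^ 2) ^ (x : ℕ) *
          ((if c = x then q else if x < c then q - t else 0) *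
          (if d = x then q else if x < d then q - t else 0) - if c = x then if d = x then 1 else 0
            else 0) = (q - t) * q := by
      intro c d hcd
      rw [← h5 c, ← sum_ite_pow]
      refine Finset.sum_congr rfl fun x _ => congrArg _ ?_
      rcases lt_trichotomy x c with h | h | h
      · have := h.trans_le hcd
        simp [h, h.ne, h.ne', this, this.ne']
        ring
      · subst h
        rcases hcd.eq_or_lt with h | h
        · subst h
          simp
          linear_combination hqt
        · simp [h, h.ne']
      · simp [h.ne, h.ne', not_lt_of_gt h]
    intro c d
    rcases le_total c d with h | h
    · exact h6 c d h
    · rw [← h6 d c h]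
      refine Finset.sum_congr rfl fun x _ => congrArg _ ?_
      rw [mul_comm]
      congr 1
      split_ifs <;> rfl
  rw [h2]
  simp only [h3, Finset.sum_add_distrib, Finset.sum_ite_eq, Finset.mem_univ, if_true]
  congr 1
  · simp only [partialTrace_apply, Finset.smul_sum]
  · rw [Finset.sum_comm]
    have : ∀ c : Fin n, ∑ x : Fin n, ∑ d : Fin n, ((t ^ 2) ^ (x : ℕ) *
          ((if c = x then q else if x < c then q - t else 0) *
          (if d = x then q else if x < d then q - t else 0) - if c = x then if d = x then 1 else 0
            else 0)) • (e i c c * Y * e i d d) = ((q - t) * q) • (e i c c * Y) := by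
      intro c
      rw [Finset.sum_comm]
      simp only [← Finset.sum_smul, h4, ← Finset.smul_sum, ← Finset.mul_sum, he.one, mul_one]
    simp only [this, ← Finset.smul_sum, ← Finset.sum_mul, he.one, one_mul]

/-- Conjugation by the Hecke symmetry does not change the partial `q`-trace. The inverse of the
Hecke symmetry `S` is `S - (q - t)`. -/
lemma partialTrace_conj (he : IsMatrixUnits e) {q t : K} (hqt : q * t = 1) (i : ℕ)
    {Y : M} (hY : CommutesAt e (i + 1) Y) :
    partialTrace t e (i + 1) (heckeOp q t e i * Y *
      (heckeOp q t e i - algebraMap K M (q - t))) = partialTrace t e i Y := by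
  rw [mul_sub, map_sub, he.partialTrace_heckeOp_mul_mul hqt i hY, ← Algebra.commutes,
    ← Algebra.smul_def, map_smul, hY.partialTrace_mul', he.partialTrace_heckeOp hqt,
    ← Algebra.smul_def, smul_smul, add_sub_cancel_right]

end IsMatrixUnits

end MatrixUnits

/-! ### The reflection equation and the Cayley-Hamilton recursion -/

section Tower

variable {n : ℕ} {K M : Type*} [CommRing K] [Ring M] [Algebra K M]

/-- Conjugation by a unit preserves commutation. -/
lemma commute_of_semiconjBy {u a a' b b' : M} (hu : IsUnit u) (ha : SemiconjBy u a a')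
    (hb : SemiconjBy u b b') (h : Commute a b) : Commute a' b' := by
  refine hu.mul_right_cancel ?_
  rw [mul_assoc, ← hb.eq, ← mul_assoc, ← ha.eq, mul_assoc, h.eq, mul_assoc b', ← ha.eq,
    ← mul_assoc b', ← hb.eq, mul_assoc]

/-- Matrix units on an infinite tensor power whose Hecke symmetries satisfy the Hecke and braid
relations, and a matrix `X` in the zeroth tensor factor satisfying the reflection equation. -/
structure IsReflectionTower (q t : K) (e : ℕ → Fin n → Fin n → M) (X : M) : Prop where
  units : IsMatrixUnits e
  hecke : IsHeckeFamily q t (heckeOp q t e)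
  commutesAt : ∀ j, 0 < j → CommutesAt e j X
  reflection : Commute (heckeOp q t e 0 * X * heckeOp q t e 0) X

/-- The copies `X_{i+1} = S_i X_i S_i⁻¹` of `X_0 = X`. -/
def braidCopy (q t : K) (e : ℕ → Fin n → Fin n → M) (X : M) : ℕ → M
  | 0 => X
  | i + 1 => heckeOp q t e i * braidCopy q t e X i * (heckeOp q t e i - algebraMap K M (q - t))

/-- The product `X_i X_{i+1} ⋯ X_{i+k}`. -/
def braidProd (q t : K) (e : ℕ → Fin n → Fin n → M) (X : M) : ℕ → ℕ → M
  | i, 0 => braidCopy q t e X i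
  | i, k + 1 => braidCopy q t e X i * braidProd q t e X (i + 1) k

/-- The `q`-trace over the tensor factors `i + 1, …, i + k`. -/
def iterTrace (t : K) (e : ℕ → Fin n → Fin n → M) : ℕ → ℕ → M →ₗ[K] M
  | _, 0 => LinearMap.id
  | i, k + 1 => partialTrace t e (i + 1) ∘ₗ iterTrace t e (i + 1) k

/-- The partial Cayley-Hamilton expression `σ_k - Y σ_{k-1} + ⋯ + (-1)^k Y^k`, where `σ_0` is
read as `1`. -/
def cayley (σ : ℕ → M) (Y : M) : ℕ → M
  | 0 => 1
  | k + 1 => σ (k + 1) - Y * cayley σ Y k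

lemma map_cayley {R R' : Type*} [Ring R] [Ring R'] (φ : R →+* R') (σ : ℕ → R) (Y : R) :
    ∀ k, φ (cayley σ Y k) = cayley (fun k => φ (σ k)) (φ Y) k
  | 0 => map_one φ
  | k + 1 => by rw [cayley, map_sub, map_mul, map_cayley φ σ Y k, cayley]

lemma iterTrace_mul (t : K) {e : ℕ → Fin n → Fin n → M} {H : M} (Y : M) : ∀ (k i : ℕ),
    (∀ j, i < j → CommutesAt e j H) → iterTrace t e i k (H * Y) = H * iterTrace t e i k Y
  | 0, _, _ => rfl
  | k + 1, i, h => by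
    rw [iterTrace, LinearMap.comp_apply, LinearMap.comp_apply,
      iterTrace_mul t Y k (i + 1) fun j hj => h j (by omega),
      (h (i + 1) (by omega)).partialTrace_mul]

lemma iterTrace_mul' (t : K) {e : ℕ → Fin n → Fin n → M} {H : M} (Y : M) : ∀ (k i : ℕ),
    (∀ j, i < j → CommutesAt e j H) → iterTrace t e i k (Y * H) = iterTrace t e i k Y * H
  | 0, _, _ => rfl
  | k + 1, i, h => by
    rw [iterTrace, LinearMap.comp_apply, LinearMap.comp_apply,
      iterTrace_mul' t Y k (i + 1) fun j hj => h j (by omega),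
      (h (i + 1) (by omega)).partialTrace_mul']

/-- The iterated `q`-trace is cyclic with respect to the `S_j` that involve only traced factors. -/
lemma IsMatrixUnits.iterTrace_comm {e : ℕ → Fin n → Fin n → M} (he : IsMatrixUnits e) (q t : K)
    (Y : M) : ∀ (k i j : ℕ), i < j → j < i + k →
      iterTrace t e i k (heckeOp q t e j * Y) = iterTrace t e i k (Y * heckeOp q t e j)
  | 0, _, _, _, _ => by omega
  | 1, _, _, _, _ => by omega
  | k + 2, i, j, h1, h2 => by
    rcases (Nat.succ_le_of_lt h1).eq_or_lt with rfl | h1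
    · have : ∀ l, i + 1 + 1 < l → CommutesAt e l (heckeOp q t e i.succ) := fun l hl =>
        he.commutesAt_heckeOp q t (by omega) (by omega)
      simp only [iterTrace, LinearMap.comp_apply]
      rw [iterTrace_mul t _ _ _ this, iterTrace_mul' t _ _ _ this]
      exact he.partialTrace_partialTrace_comm q t (i + 1) _
    · rw [iterTrace, LinearMap.comp_apply, LinearMap.comp_apply,
        he.iterTrace_comm q t Y (k + 1) (i + 1) j h1 (by omega)]

lemma IsMatrixUnits.iterTrace_cosetSum_comm {e : ℕ → Fin n → Fin n → M} (he : IsMatrixUnits e)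
    (q t : K) (k i : ℕ) : ∀ (m a : ℕ) (Y : M), i < a → a + m ≤ i + k →
      iterTrace t e i k (cosetSum t (heckeOp q t e) a m * Y) =
        iterTrace t e i k (Y * cosetSum t (heckeOp q t e) a m)
  | 0, _, _, _, _ => by simp [cosetSum]
  | m + 1, a, Y, h1, h2 => by
    rw [cosetSum, sub_mul, mul_sub, one_mul, mul_one, map_sub, map_sub, smul_mul_assoc,
      mul_smul_comm, map_smul, map_smul, mul_assoc, he.iterTrace_comm q t _ k i a h1 (by omega),
      mul_assoc, he.iterTrace_cosetSum_comm q t k i m (a + 1) _ (by omega) (by omega), mul_assoc]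

namespace IsReflectionTower

variable {q t : K} {e : ℕ → Fin n → Fin n → M} {X : M}

local notation "S" => heckeOp q t e
local notation "X_" => braidCopy q t e X

lemma mul_inv (h : IsReflectionTower q t e X) (i : ℕ) :
    S i * (S i - algebraMap K M (q - t)) = 1 := by
  rw [mul_sub, h.hecke.quad, ← Algebra.commutes, ← Algebra.smul_def, add_sub_cancel_right]

lemma inv_mul (h : IsReflectionTower q t e X) (i : ℕ) :
    (S i - algebraMap K M (q - t)) * S i = 1 := by
  rw [sub_mul, h.hecke.quad, ← Algebra.smul_def, add_sub_cancel_right]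

lemma isUnit (h : IsReflectionTower q t e X) (i : ℕ) : IsUnit (S i) :=
  ⟨⟨_, _, h.mul_inv i, h.inv_mul i⟩, rfl⟩

lemma eq_conj (h : IsReflectionTower q t e X) {i : ℕ} {Y Y' : M} (hY : SemiconjBy (S i) Y Y') :
    Y' = S i * Y * (S i - algebraMap K M (q - t)) := by
  rw [hY.eq, mul_assoc, h.mul_inv, mul_one]

lemma semiconjBy (h : IsReflectionTower q t e X) (i : ℕ) :
    SemiconjBy (S i) (X_ i) (X_ (i + 1)) := by
  rw [SemiconjBy, braidCopy, mul_assoc, h.inv_mul, mul_one]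

lemma commutesAt_braidCopy (h : IsReflectionTower q t e X) : ∀ (i j : ℕ), i < j →
    CommutesAt e j (X_ i)
  | 0, j, hj => h.commutesAt j hj
  | i + 1, j, hj => by
    have hS := h.units.commutesAt_heckeOp q t (i := i) (j := j) (by omega) (by omega)
    refine (hS.mul (h.commutesAt_braidCopy i j (by omega))).mul (hS.sub fun a b => ?_)
    exact Algebra.commute_algebraMap_right _ _

lemma commute_braidCopy_of_lt (h : IsReflectionTower q t e X) {i j : ℕ} (hij : i < j) :
    Commute (S j) (X_ i) :=
  IsMatrixUnits.commute_heckeOp (h.commutesAt_braidCopy i j hij)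
    (h.commutesAt_braidCopy i (j + 1) (by omega))

/-- The reflection equation holds at each position: conjugation by `S_i S_{i+1}` moves `S_i` to
`S_{i+1}` and `X_i` to `X_{i+1}`. -/
lemma reflection_braidCopy (h : IsReflectionTower q t e X) : ∀ i : ℕ,
    Commute (S i * X_ i * S i) (X_ i)
  | 0 => h.reflection
  | i + 1 => by
    have h1 : SemiconjBy (S i * S (i + 1)) (S i) (S (i + 1)) := by
      rw [SemiconjBy, h.hecke.braid, mul_assoc]
    have h2 : SemiconjBy (S i * S (i + 1)) (X_ i) (X_ (i + 1)) :=
      (h.semiconjBy i).mul_left (h.commute_braidCopy_of_lt (Nat.lt_succ_self i))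
    exact commute_of_semiconjBy ((h.isUnit i).mul (h.isUnit (i + 1)))
      ((h1.mul_right h2).mul_right h1) h2 (h.reflection_braidCopy i)

lemma commute_braidCopy_mul (h : IsReflectionTower q t e X) (i : ℕ) :
    Commute (S i) (X_ i * X_ (i + 1)) := by
  have h1 := (h.reflection_braidCopy i).eq
  rw [Commute, SemiconjBy, braidCopy]
  calc _ = (S i * X_ i * S i * X_ i) * (S i - algebraMap K M (q - t)) := by
        simp only [mul_assoc]
    _ = X_ i * S i * X_ i * (S i * (S i - algebraMap K M (q - t))) := by
        rw [h1]; simp only [mul_assoc]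
    _ = X_ i * S i * X_ i * ((S i - algebraMap K M (q - t)) * S i) := by
        rw [h.mul_inv, h.inv_mul]
    _ = _ := by simp only [mul_assoc]

lemma commute_braidCopy_of_le (h : IsReflectionTower q t e X) (i : ℕ) : ∀ l, i + 2 ≤ l →
    Commute (S i) (X_ l) := by
  refine Nat.le_induction ?_ fun l hl ih => ?_
  · have h1 : SemiconjBy (S (i + 1) * S i) (S (i + 1)) (S i) := by
      rw [SemiconjBy, ← h.hecke.braid, mul_assoc]
    exact commute_of_semiconjBy ((h.isUnit (i + 1)).mul (h.isUnit i)) h1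
      ((h.semiconjBy (i + 1)).mul_left (h.semiconjBy i))
      (h.commute_braidCopy_of_lt (Nat.lt_succ_self i))
  · have h1 : Commute (S i) (S l) := h.hecke.commute hl
    rw [braidCopy]
    exact (h1.mul_right ih).mul_right (h1.sub_right (Algebra.commute_algebraMap_right _ _))

lemma commute_braidProd_of_le (h : IsReflectionTower q t e X) (i : ℕ) : ∀ (k l : ℕ), i + 2 ≤ l →
    Commute (S i) (braidProd q t e X l k)
  | 0, l, hl => h.commute_braidCopy_of_le i l hl
  | k + 1, l, hl => (h.commute_braidCopy_of_le i l hl).mul_right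
      (h.commute_braidProd_of_le i k (l + 1) (by omega))

/-- The symmetry of the product `X_i ⋯ X_{i+k}`, through which the reflection equation enters the
Cayley-Hamilton identity. -/
lemma commute_braidProd (h : IsReflectionTower q t e X) : ∀ (k i j : ℕ), i ≤ j → j < i + k →
    Commute (S j) (braidProd q t e X i k)
  | 0, _, _, _, _ => by omega
  | 1, i, j, h1, h2 => by
    obtain rfl : i = j := by omega
    exact h.commute_braidCopy_mul i
  | k + 2, i, j, h1, h2 => by
    rcases h1.eq_or_lt with rfl | h1
    · rw [braidProd, braidProd, ← mul_assoc]
      exact (h.commute_braidCopy_mul i).mul_right (h.commute_braidProd_of_le i k (i + 2) le_rfl)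
    · rw [braidProd]
      exact (h.commute_braidCopy_of_lt h1).mul_right
        (h.commute_braidProd (k + 1) (i + 1) j (by omega) (by omega))

section Newton

variable {σ : ℕ → M}

lemma semiconjBy_cayley (h : IsReflectionTower q t e X) (hσ : ∀ k j, CommutesAt e j (σ k)) (i : ℕ) :
    ∀ k, SemiconjBy (S i) (X_ i * cayley σ (X_ i) k) (X_ (i + 1) * cayley σ (X_ (i + 1)) k)
  | 0 => by simpa [cayley] using h.semiconjBy i
  | k + 1 => (h.semiconjBy i).mul_right
      (SemiconjBy.sub_right (IsMatrixUnits.commute_heckeOp (hσ _ _) (hσ _ _))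
        (h.semiconjBy_cayley hσ i k))

lemma commutesAt_cayley (h : IsReflectionTower q t e X) (hσ : ∀ k j, CommutesAt e j (σ k))
    {i j : ℕ} (hij : i < j) : ∀ k, CommutesAt e j (cayley σ (X_ i) k)
  | 0 => .one
  | k + 1 => (hσ _ _).sub ((h.commutesAt_braidCopy i j hij).mul (h.commutesAt_cayley hσ hij k))

/-- The `q`-trace of a polynomial in `X_i` does not depend on `i`. -/
lemma partialTrace_cayley (h : IsReflectionTower q t e X) (hσ : ∀ k j, CommutesAt e j (σ k))
    {k : ℕ} {N : M} (hN : partialTrace t e 0 (X * cayley σ X k) = N) : ∀ i : ℕ,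
    partialTrace t e i (X_ i * cayley σ (X_ i) k) = N
  | 0 => hN
  | i + 1 => by
    rw [h.eq_conj (h.semiconjBy_cayley hσ i k), h.units.partialTrace_conj h.hecke.qt,
      h.partialTrace_cayley hσ hN i]
    exact (h.commutesAt_braidCopy i _ (by omega)).mul (h.commutesAt_cayley hσ (by omega) k)

variable (h : IsReflectionTower q t e X) (hu : ∀ k, IsUnit (qInt (t ^ 2) (k + 1)))
  (hσ : ∀ k j, CommutesAt e j (σ k))
  (hN : ∀ k, partialTrace t e 0 (X * cayley σ X k) = qInt (t ^ 2) (k + 1) • σ (k + 1))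

include h hu hσ hN

/-- The Cayley-Hamilton expression of degree `k + 1` as a partial trace. By cyclicity the
antisymmetrizer `A` of the last `k + 1` factors absorbs the coset representatives except for their
first letter `S_i`, so that the trace of `Z A (1 - t [k + 1] S_i)` is left, where
`Z = X_{i+1} ⋯ X_{i+k+1}` and `[k + 1]` is the quantum integer. -/
lemma iterTrace_step {k i : ℕ}
    (ih : iterTrace t e (i + 1) k (braidProd q t e X (i + 1) k * antisym t S (i + 1) k) =
      qFac (t ^ 2) k • (X_ (i + 1) * cayley σ (X_ (i + 1)) k)) :
    iterTrace t e i (k + 1) (braidProd q t e X (i + 1) k * antisym t S i (k + 1)) =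
      qFac (t ^ 2) (k + 1) • cayley σ (X_ i) (k + 1) := by
  set A := antisym t S (i + 1) k with hA
  set Z := braidProd q t e X (i + 1) k with hZ
  set c := cosetSum t S (i + 1) k with hc
  have hZc : Commute Z c := commute_cosetSum t S k (i + 1) fun j h1 h2 =>
    (h.commute_braidProd k (i + 1) j h1 h2).symm
  have hcA : c * A = qInt (t ^ 2) (k + 1) • A :=
    IsHeckeFamily.cosetSum_mul_of_absorb k (i + 1) fun l h1 h2 =>
      h.hecke.mul_antisym hu k (i + 1) l h1 h2
  have e1 : iterTrace t e i (k + 1) (Z * A) =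
      (qFac (t ^ 2) k * qInt (t ^ 2) (k + 1)) • σ (k + 1) := by
    rw [iterTrace, LinearMap.comp_apply, ih, map_smul, h.partialTrace_cayley hσ (hN k), smul_smul]
  have e2 : iterTrace t e i (k + 1) (Z * A * S i) =
      (qFac (t ^ 2) k * q) • (X_ i * cayley σ (X_ i) k) := by
    rw [iterTrace, LinearMap.comp_apply, iterTrace_mul' t _ _ _ fun j hj =>
      h.units.commutesAt_heckeOp q t (by omega) (by omega), ih, smul_mul_assoc, map_smul,
      h.eq_conj (h.semiconjBy_cayley hσ i k), mul_assoc, h.inv_mul, mul_one,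
      CommutesAt.partialTrace_mul', h.units.partialTrace_heckeOp h.hecke.qt, ← Algebra.smul_def,
      smul_smul]
    exact (h.commutesAt_braidCopy i _ (by omega)).mul (h.commutesAt_cayley hσ (by omega) k)
  have e3 : iterTrace t e i (k + 1) (Z * (A * (S i * c))) =
      qInt (t ^ 2) (k + 1) • iterTrace t e i (k + 1) (Z * A * S i) := by
    have : Z * (A * (S i * c)) = (Z * A * S i) * c := by simp only [mul_assoc]
    rw [this, ← h.units.iterTrace_cosetSum_comm q t (k + 1) i k (i + 1) _ (by omega) (by omega),
      ← hc, ← map_smul]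
    congr 1
    rw [← mul_assoc, ← mul_assoc, ← hZc.eq, mul_assoc Z, hcA, mul_smul_comm, smul_mul_assoc]
  rw [antisym, cosetSum, ← hA, ← hc, mul_sub, mul_one, mul_smul_comm, mul_sub, mul_smul_comm,
    map_sub, map_smul, e3, e1, e2, cayley, qFac_succ]
  linear_combination (norm := module) -(h.hecke.qt) •
    ((qFac (t ^ 2) k * qInt (t ^ 2) (k + 1)) • (X_ i * cayley σ (X_ i) k))

/-- The companion of `iterTrace_step` with one more factor `X_i`, by which the induction
proceeds. -/
lemma iterTrace_braidProd_mul_antisym : ∀ (k i : ℕ),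
    iterTrace t e i k (braidProd q t e X i k * antisym t S i k) =
      qFac (t ^ 2) k • (X_ i * cayley σ (X_ i) k)
  | 0, i => by simp [iterTrace, braidProd, antisym, qFac, cayley]
  | k + 1, i => by
    rw [braidProd, mul_assoc, iterTrace_mul t _ _ _ fun j hj => h.commutesAt_braidCopy i j hj,
      iterTrace_step h hu hσ hN (iterTrace_braidProd_mul_antisym k (i + 1)), mul_smul_comm]

/-- The Cayley-Hamilton identity: the expression of degree `k + 1` is a partial trace of a
multiple of the antisymmetrizer on `k + 2` tensor factors. -/
lemma cayley_eq_zero {k : ℕ} (h0 : antisym t S 0 (k + 1) = 0) : cayley σ X (k + 1) = 0 := by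
  have := iterTrace_step h hu hσ hN (iterTrace_braidProd_mul_antisym h hu hσ hN k 1)
  rw [h0, mul_zero, map_zero] at this
  exact (isUnit_qFac hu (k + 1)).smul_eq_zero.1 this.symm

end Newton

/-- The `q`-traces of the powers of `X` commute with `X`: taking the partial trace of
`X S X^m S⁻¹ = S⁻¹ X^m S X`. -/
lemma commute_partialTrace_pow (h : IsReflectionTower q t e X) (m : ℕ) :
    Commute X (partialTrace t e 0 (X ^ m)) := by
  have hX := h.commutesAt 1 one_pos
  have hm := hX.pow m
  have h1 := (h.reflection.pow_right m).eq
  have h2 : X * (S 0 * X ^ m * (S 0 - algebraMap K M (q - t))) =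
      (S 0 - algebraMap K M (q - t)) * X ^ m * S 0 * X := by
    have : S 0 * (X * (S 0 * X ^ m * (S 0 - algebraMap K M (q - t)))) =
        S 0 * ((S 0 - algebraMap K M (q - t)) * X ^ m * S 0 * X) := by
      calc _ = S 0 * X * S 0 * X ^ m * (S 0 - algebraMap K M (q - t)) := by simp only [mul_assoc]
        _ = X ^ m * S 0 * X * (S 0 * (S 0 - algebraMap K M (q - t))) := by
          rw [h1]; simp only [mul_assoc]
        _ = (S 0 * (S 0 - algebraMap K M (q - t))) * X ^ m * S 0 * X := by
          rw [h.mul_inv, mul_one, one_mul]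
        _ = _ := by simp only [mul_assoc]
    exact (h.isUnit 0).mul_left_cancel this
  have h3 : (S 0 - algebraMap K M (q - t)) * X ^ m * S 0 =
      S 0 * X ^ m * (S 0 - algebraMap K M (q - t)) + (q - t) • (S 0 * X ^ m - X ^ m * S 0) := by
    rw [mul_sub, sub_mul, sub_mul, ← Algebra.commutes, ← Algebra.smul_def, ← Algebra.smul_def,
      smul_mul_assoc, smul_sub]
    abel
  have h4 : partialTrace t e (0 + 1) (S 0 * X ^ m - X ^ m * S 0) = 0 := by
    rw [map_sub, hm.partialTrace_mul, hm.partialTrace_mul',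
      h.units.partialTrace_heckeOp h.hecke.qt, Algebra.commutes, sub_self]
  have h5 := congrArg (partialTrace t e (0 + 1)) h2
  rwa [h3, hX.partialTrace_mul, hX.partialTrace_mul', map_add, map_smul, h4,
    h.units.partialTrace_conj h.hecke.qt 0 hm, smul_zero, add_zero] at h5

end IsReflectionTower

end Tower

/-! ### Operators on functions of infinite words -/

section Words

variable {n : ℕ} {K A : Type*} [CommRing K] [Ring A] [Algebra K A]

/-- The matrix unit in the `j`-th tensor factor, acting on functions of infinite words. -/
def wordUnit (K A : Type*) [CommRing K] [Ring A] [Algebra K A] (j : ℕ) (a b : Fin n) :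
    Module.End K ((ℕ → Fin n) → A) where
  toFun f w := if w j = a then f (Function.update w j b) else 0
  map_add' f g := by ext w; simp only [Pi.add_apply]; split_ifs <;> simp
  map_smul' r f := by ext w; simp

lemma wordUnit_apply (j : ℕ) (a b : Fin n) (f : (ℕ → Fin n) → A) (w : ℕ → Fin n) :
    wordUnit K A j a b f w = if w j = a then f (Function.update w j b) else 0 := rfl

lemma isMatrixUnits_wordUnit : IsMatrixUnits (wordUnit (n := n) K A) where
  mul j a b c d := by
    ext f w
    rw [Module.End.mul_apply, wordUnit_apply, wordUnit_apply]
    by_cases h : b = c <;> simp [h, wordUnit_apply]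
  comm i j hij a b c d := by
    ext f w
    simp only [Module.End.mul_apply, wordUnit_apply, Function.update_of_ne hij,
      Function.update_of_ne hij.symm, Function.update_comm hij]
    split_ifs <;> rfl
  one j := by
    ext f w
    simp [LinearMap.sum_apply, wordUnit_apply]

lemma update_update_eq_comp_swap (w : ℕ → Fin n) {i j : ℕ} (hij : i ≠ j) :
    Function.update (Function.update w i (w j)) j (w i) = w ∘ Equiv.swap i j := by
  ext k
  rcases eq_or_ne k j with rfl | hj
  · simp
  rcases eq_or_ne k i with rfl | hi
  · simp [hj]
  · simp [hi, hj, Equiv.swap_apply_of_ne_of_ne hi hj]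

lemma heckeOp_wordUnit_apply (q t : K) (i : ℕ) (f : (ℕ → Fin n) → A) (w : ℕ → Fin n) :
    heckeOp q t (wordUnit K A) i f w =
      (if w i = w (i + 1) then q else 1) • f (w ∘ Equiv.swap i (i + 1)) +
        (if w (i + 1) < w i then q - t else 0) • f w := by
  have hi : i ≠ i + 1 := by omega
  have hi' : i + 1 ≠ i := by omega
  simp only [heckeOp, LinearMap.sum_apply, Finset.sum_apply, LinearMap.add_apply, Pi.add_apply,
    LinearMap.smul_apply, Pi.smul_apply, Module.End.mul_apply, wordUnit_apply,
    Function.update_of_ne hi']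
  rw [Finset.sum_eq_single (w i), Finset.sum_eq_single (w (i + 1))]
  · simp [update_update_eq_comp_swap w hi]
  · intro b _ hb
    simp [hb.symm]
  · simp
  · intro b _ hb
    simp [hb.symm]
  · simp

lemma heckeOp_wordUnit_quad {q t : K} (hqt : q * t = 1) (i : ℕ) :
    heckeOp q t (wordUnit (n := n) K A) i * heckeOp q t (wordUnit K A) i =
      1 + (q - t) • heckeOp q t (wordUnit K A) i := by
  ext f w
  have e : (w ∘ Equiv.swap i (i + 1)) ∘ Equiv.swap i (i + 1) = w := by ext; simp
  simp only [Module.End.mul_apply, LinearMap.add_apply, Module.End.one_apply, LinearMap.smul_apply,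
    Pi.add_apply, Pi.smul_apply, heckeOp_wordUnit_apply, e, Function.comp_apply,
    Equiv.swap_apply_left, Equiv.swap_apply_right]
  rcases lt_trichotomy (w i) (w (i + 1)) with h | h | h
  · simp only [h, h.ne, h.ne', if_true, if_false, not_lt_of_gt h]
    match_scalars <;> ring
  · have : w ∘ Equiv.swap i (i + 1) = w := by
      rw [← update_update_eq_comp_swap w (by omega), ← h, Function.update_eq_self, h,
        Function.update_eq_self]
    simp only [this, h, if_true, lt_irrefl, if_false]
    match_scalars
    linear_combination hqt
  · simp only [h, h.ne, h.ne', if_true, if_false, not_lt_of_gt h]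
    match_scalars <;> ring

lemma comp_swap_eq_self {w : ℕ → Fin n} {i j : ℕ} (h : w i = w j) : w ∘ Equiv.swap i j = w := by
  ext k
  simp only [Function.comp_apply]
  rw [Equiv.swap_apply_def]
  split_ifs <;> simp_all

lemma heckeOp_wordUnit_braid {q t : K} (hqt : q * t = 1) (i : ℕ) :
    heckeOp q t (wordUnit (n := n) K A) i * heckeOp q t (wordUnit K A) (i + 1) *
      heckeOp q t (wordUnit K A) i =
    heckeOp q t (wordUnit K A) (i + 1) * heckeOp q t (wordUnit K A) i *
      heckeOp q t (wordUnit K A) (i + 1) := by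
  ext f w
  obtain ⟨s, hs⟩ : ∃ s, s = Equiv.swap i (i + 1) := ⟨_, rfl⟩
  obtain ⟨s', hs'⟩ : ∃ s, s = Equiv.swap (i + 1) (i + 1 + 1) := ⟨_, rfl⟩
  have s0 : s i = i + 1 := by simp [hs]
  have s1 : s (i + 1) = i := by simp [hs]
  have s2 : s (i + 1 + 1) = i + 1 + 1 := by
    rw [hs, Equiv.swap_apply_of_ne_of_ne (by omega) (by omega)]
  have s'0 : s' i = i := by rw [hs', Equiv.swap_apply_of_ne_of_ne (by omega) (by omega)]
  have s'1 : s' (i + 1) = i + 1 + 1 := by simp [hs']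
  have s'2 : s' (i + 1 + 1) = i + 1 := by simp [hs']
  have ss (u : ℕ → Fin n) : (u ∘ s) ∘ s = u := by ext; simp [hs]
  have ss' (u : ℕ → Fin n) : (u ∘ s') ∘ s' = u := by ext; simp [hs']
  have br : ((w ∘ s) ∘ s') ∘ s = ((w ∘ s') ∘ s) ∘ s' := by
    have : s * s' * s = s' * s * s' := by
      have e1 := Equiv.swap_mul_swap_mul_swap (x := i) (y := i + 1) (z := i + 1 + 1)
        (by omega) (by omega)
      have e2 := Equiv.swap_mul_swap_mul_swap (x := i + 1 + 1) (y := i + 1) (z := i)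
        (by omega) (by omega)
      rw [hs, hs', e1, Equiv.swap_comm i (i + 1), Equiv.swap_comm (i + 1) (i + 1 + 1), e2,
        Equiv.swap_comm]
    ext k
    exact congrArg (fun g : Equiv.Perm ℕ => (w (g k) : ℕ)) this
  simp only [Module.End.mul_apply, heckeOp_wordUnit_apply, ← hs, ← hs', Function.comp_apply,
    s0, s1, s2, s'0, s'1, s'2, ss, ss', ← br]
  have c1 (u : ℕ → Fin n) (h : u i = u (i + 1)) : u ∘ s = u := by rw [hs, comp_swap_eq_self h]
  have c2 (u : ℕ → Fin n) (h : u (i + 1) = u (i + 1 + 1)) : u ∘ s' = u := by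
    rw [hs', comp_swap_eq_self h]
  rcases eq_or_ne (w i) (w (i + 1)) with h1 | h1
  · simp only [c1 w h1, h1, if_true, lt_irrefl, if_false]
    rcases lt_trichotomy (w (i + 1)) (w (i + 1 + 1)) with h | h | h
    · simp only [h, h.ne, h.ne', if_true, if_false, not_lt_of_gt h]
      match_scalars <;> grind
    · simp only [c2 w h, c1 w h1, h, if_true, lt_irrefl, if_false]
    · simp only [h, h.ne, h.ne', if_true, if_false, not_lt_of_gt h]
      match_scalars <;> grind
  rcases eq_or_ne (w (i + 1)) (w (i + 1 + 1)) with h2 | h2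
  · rw [c2 w h2] at br
    simp only [br, c2 w h2, h2, if_true, lt_irrefl, if_false]
    rw [h2] at h1
    rcases lt_or_gt_of_ne h1 with h | h <;>
    · simp only [h, h.ne, h.ne', if_true, if_false, not_lt_of_gt h]
      match_scalars <;> grind
  rcases eq_or_ne (w i) (w (i + 1 + 1)) with h3 | h3
  · have e1 : (w ∘ s) ∘ s' = w ∘ s := c2 _ (by simp [s1, s2, h3])
    have e2 : (w ∘ s') ∘ s = w ∘ s' := c1 _ (by simp [s'0, s'1, h3])
    simp only [e1, e2, ss, h3, if_true, lt_irrefl, if_false]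
    rw [h3] at h1
    rcases lt_or_gt_of_ne h1 with h | h <;>
    · simp only [h, h.ne, h.ne', if_true, if_false, not_lt_of_gt h]
      match_scalars <;> grind
  · rcases lt_or_gt_of_ne h1 with h1 | h1 <;> rcases lt_or_gt_of_ne h2 with h2 | h2 <;>
    rcases lt_or_gt_of_ne h3 with h3 | h3 <;>
    · simp only [h1, h1.ne, h1.ne', h2, h2.ne, h2.ne', h3, h3.ne, h3.ne', if_true, if_false,
        not_lt_of_gt h1, not_lt_of_gt h2, not_lt_of_gt h3]
      match_scalars <;> grind

end Words

/-! ### Matrices satisfying the reflection equation as operators -/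

section Vanishing

variable {n : ℕ} {K A : Type*} [CommRing K] [Ring A] [Algebra K A]

/-- There are no nonzero `q`-antisymmetric functions of `n + 1` letters from an alphabet with `n`
letters. -/
lemma eq_zero_of_heckeOp_eq {q t : K} (hqt : q * t = 1) (hu : IsUnit (q + t))
    {g : (ℕ → Fin n) → A} (hg : ∀ j < n, heckeOp q t (wordUnit K A) j g = -t • g) : g = 0 := by
  have hq : IsUnit q := .of_mul_eq_one t hqt
  have ht : IsUnit t := .of_mul_eq_one q (by rw [mul_comm, hqt])
  have h0 : ∀ j < n, ∀ w : ℕ → Fin n, w j = w (j + 1) → g w = 0 := by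
    intro j hj w hw
    have := congrFun (hg j hj) w
    rw [heckeOp_wordUnit_apply, comp_swap_eq_self hw, hw, if_pos rfl, if_neg (lt_irrefl _),
      Pi.smul_apply] at this
    refine hu.smul_eq_zero.1 ?_
    linear_combination (norm := module) this
  -- Exchanging adjacent letters changes `g` by a unit.
  have h1 : ∀ j < n, ∀ w : ℕ → Fin n, g (w ∘ Equiv.swap j (j + 1)) = 0 → g w = 0 := by
    intro j hj w hw
    by_cases hne : w j = w (j + 1)
    · exact h0 j hj w hne
    have := congrFun (hg j hj) w
    rw [heckeOp_wordUnit_apply, hw, smul_zero, zero_add, Pi.smul_apply] at this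
    split_ifs at this
    · refine hq.smul_eq_zero.1 ?_
      linear_combination (norm := module) this
    · refine ht.smul_eq_zero.1 ?_
      linear_combination (norm := module) this
  -- Two equal letters can be moved next to each other.
  have h2 : ∀ d i : ℕ, i + d + 1 ≤ n → ∀ w : ℕ → Fin n, w i = w (i + d + 1) → g w = 0 := by
    intro d
    induction d with
    | zero => exact fun i hi w hw => h0 i (by omega) w hw
    | succ d ih =>
      intro i hi w hw
      refine h1 (i + d + 1) (by omega) w (ih i (by omega) _ ?_)
      rw [Function.comp_apply, Function.comp_apply, Equiv.swap_apply_left,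
        Equiv.swap_apply_of_ne_of_ne (by omega) (by omega), hw, add_assoc i d 1]
  ext w
  obtain ⟨x, y, hxy, hw⟩ := Fintype.exists_ne_map_eq_of_card_lt (fun k : Fin (n + 1) => w k)
    (by simp)
  wlog hlt : x < y generalizing x y
  · exact this y x hxy.symm hw.symm (lt_of_le_of_ne (not_lt.1 hlt) hxy.symm)
  have hlt' : (x : ℕ) < y := hlt
  refine h2 (y - x - 1) x (by omega) w ?_
  rw [show (x : ℕ) + (y - x - 1) + 1 = y by omega]
  exact hw

end Vanishing

section MatrixAction

variable {n : ℕ} {K A : Type*} [CommRing K] [Ring A] [Algebra K A] {W T : Type*} [Fintype T]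
  [DecidableEq T]

/-- The action of matrices on functions on `W` through a coordinate `get : W → T` of `W` that can
be overwritten by means of `set`. The hypotheses are the laws of reading and overwriting. -/
def coordOp (K : Type*) [CommRing K] [Algebra K A] (get : W → T) (set : W → T → W)
    (h1 : ∀ w c, get (set w c) = c) (h2 : ∀ w c d, set (set w c) d = set w d)
    (h3 : ∀ w, set w (get w) = w) : Matrix T T A →+* Module.End K (W → A) where
  toFun M :=
    { toFun := fun f w => ∑ c, M (get w) c * f (set w c)
      map_add' := fun f g => by ext w; simp [mul_add, Finset.sum_add_distrib]
      map_smul' := fun r f => by ext w; simp [Finset.smul_sum] }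
  map_one' := by
    ext f w
    simp [Matrix.one_apply, h3]
  map_mul' M N := by
    ext f w
    simp only [LinearMap.coe_mk, AddHom.coe_mk, Module.End.mul_apply, Matrix.mul_apply, h1, h2,
      Finset.sum_mul, Finset.mul_sum, mul_assoc]
    exact Finset.sum_comm
  map_zero' := by ext; simp
  map_add' M N := by ext; simp [add_mul, Finset.sum_add_distrib]

/-- The action of an `n × n` matrix on the zeroth tensor factor. -/
def matrixOp (K : Type*) [CommRing K] [Algebra K A] :
    Matrix (Fin n) (Fin n) A →+* Module.End K ((ℕ → Fin n) → A) :=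
  coordOp K (fun w => w 0) (fun w c => Function.update w 0 c) (by simp) (by simp) (by simp)

/-- The action on the tensor factors `1` and `0`, in this order. -/
def pairOp (K : Type*) [CommRing K] [Algebra K A] :
    Matrix (Fin n × Fin n) (Fin n × Fin n) A →+* Module.End K ((ℕ → Fin n) → A) :=
  coordOp K (fun w => (w 1, w 0)) (fun w c => Function.update (Function.update w 1 c.1) 0 c.2)
    (by simp) (by
      intro w c d
      rw [Function.update_comm (β := fun _ => Fin n) (zero_ne_one' ℕ), Function.update_idem,
        Function.update_idem])
    (by simp)

lemma matrixOp_apply (M : Matrix (Fin n) (Fin n) A) (f : (ℕ → Fin n) → A) (w : ℕ → Fin n) :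
    matrixOp K M f w = ∑ c, M (w 0) c * f (Function.update w 0 c) := rfl

lemma pairOp_apply (M : Matrix (Fin n × Fin n) (Fin n × Fin n) A) (f : (ℕ → Fin n) → A)
    (w : ℕ → Fin n) : pairOp K M f w =
      ∑ c, M (w 1, w 0) c * f (Function.update (Function.update w 1 c.1) 0 c.2) := rfl

lemma matrixOp_injective : Function.Injective (matrixOp (n := n) (A := A) K) := by
  refine (injective_iff_map_eq_zero _).2 fun M hM => ?_
  ext a b
  have := congrFun (congrArg (fun F => F fun v => if v 0 = b then 1 else 0) hM) (fun _ => a)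
  simpa [matrixOp_apply] using this

lemma matrixOp_scalar_apply (x : A) (f : (ℕ → Fin n) → A) (w : ℕ → Fin n) :
    matrixOp K (Matrix.scalar (Fin n) x) f w = x * f w := by
  simp [matrixOp_apply, Matrix.diagonal_apply]

lemma commutesAt_matrixOp_scalar (j : ℕ) (x : A) :
    CommutesAt (wordUnit K A) j (matrixOp K (Matrix.scalar (Fin n) x)) := by
  intro a b
  ext f w
  simp only [Module.End.mul_apply, wordUnit_apply, matrixOp_scalar_apply, mul_ite, mul_zero]

lemma commutesAt_matrixOp {j : ℕ} (hj : 0 < j) (M : Matrix (Fin n) (Fin n) A) :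
    CommutesAt (wordUnit K A) j (matrixOp K M) := by
  intro a b
  ext f w
  simp only [Module.End.mul_apply, wordUnit_apply, matrixOp_apply, mul_ite, mul_zero,
    Function.update_of_ne hj.ne', Function.update_of_ne hj.ne, Function.update_comm hj.ne']
  split_ifs <;> simp

lemma pairOp_one_kronecker (M : Matrix (Fin n) (Fin n) A) :
    pairOp K ((1 : Matrix (Fin n) (Fin n) A) ⊗ₖ M) = matrixOp K M := by
  ext f w
  rw [pairOp_apply, matrixOp_apply, Fintype.sum_prod_type, Finset.sum_eq_single (w 1)]
  · simp
  · intro b _ hb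
    simp [hb.symm]
  · simp

lemma partialTrace_matrixOp (t : K) (M : Matrix (Fin n) (Fin n) A) :
    partialTrace t (wordUnit K A) 0 (matrixOp K M) =
      matrixOp K (Matrix.scalar (Fin n) (∑ i : Fin n, (t ^ 2) ^ (i : ℕ) • M i i)) := by
  ext f w
  rw [matrixOp_scalar_apply, partialTrace_apply]
  simp [LinearMap.sum_apply, wordUnit_apply, matrixOp_apply, Finset.sum_mul]

end MatrixAction

section ReflectionEquation

variable {n : ℕ} {A : Type*} [Ring A] [Algebra Ch A]

lemma constantCoeff_q : PowerSeries.constantCoeff q = 1 := by simp [q]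

lemma q_mul_inv : q * q⁻¹ = 1 := PowerSeries.mul_inv_cancel q (by simp [q])

lemma constantCoeff_q_inv : PowerSeries.constantCoeff q⁻¹ = 1 := by
  simp [constantCoeff_q]

lemma isUnit_qInt (k : ℕ) : IsUnit (qInt (q⁻¹ ^ 2) (k + 1)) := by
  rw [PowerSeries.isUnit_iff_constantCoeff, qInt, map_sum]
  simp only [map_pow, constantCoeff_q_inv, one_pow]
  simp only [Finset.sum_const, Finset.card_range, nsmul_eq_mul, mul_one]
  exact (Nat.cast_ne_zero.2 (Nat.succ_ne_zero k)).isUnit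

lemma isUnit_q_add_inv : IsUnit (q + q⁻¹) := by
  rw [PowerSeries.isUnit_iff_constantCoeff, map_add, constantCoeff_q, constantCoeff_q_inv]
  norm_num

lemma pairOp_heckeS : pairOp Ch ((heckeS n).map (algebraMap Ch A)) =
    heckeOp q q⁻¹ (wordUnit Ch A) 0 := by
  ext f w
  rw [pairOp_apply, heckeOp_wordUnit_apply]
  have key : ∀ c : Fin n × Fin n, (heckeS n).map (algebraMap Ch A) (w 1, w 0) c *
      f (Function.update (Function.update w 1 c.1) 0 c.2) =
      (if c = (w 0, w 1) then (if w 0 = w 1 then q else 1) • f (w ∘ Equiv.swap 0 1) else 0) +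
      if c = (w 1, w 0) then (if w 1 < w 0 then q - q⁻¹ else 0) • f w else 0 := by
    rintro ⟨c, d⟩
    simp only [heckeS, Matrix.map_apply, Matrix.of_apply, ← Algebra.smul_def, Prod.mk.injEq]
    by_cases h1 : w 1 = d ∧ w 0 = c
    · obtain ⟨rfl, rfl⟩ := h1
      have e : Function.update (Function.update w 1 (w 0)) 0 (w 1) = w ∘ Equiv.swap 0 1 := by
        rw [update_update_eq_comp_swap w (by omega), Equiv.swap_comm]
      rw [e]
      by_cases h : w 0 = w 1
      · simp [h]
      · simp [h, Ne.symm h]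
    · rw [if_neg h1, if_neg (fun h : c = w 0 ∧ d = w 1 => h1 ⟨h.2.symm, h.1.symm⟩), zero_add]
      by_cases h2 : w 1 = c ∧ w 0 = d
      · obtain ⟨rfl, rfl⟩ := h2
        simp
      · rw [if_neg (fun h => h2 ⟨h.1, h.2.1⟩), if_neg (fun h => h2 ⟨h.1.symm, h.2.symm⟩)]
        simp
  rw [Finset.sum_congr rfl fun c _ => key c, Finset.sum_add_distrib, Finset.sum_ite_eq',
    Finset.sum_ite_eq', if_pos (Finset.mem_univ _), if_pos (Finset.mem_univ _)]

/-- A matrix satisfying the reflection equation `S L₂ S L₂ = L₂ S L₂ S` for the Hecke symmetry. -/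
def IsReflectionMatrix (L : Matrix (Fin n) (Fin n) A) : Prop :=
  (heckeS n).map (algebraMap Ch A) * ((1 : Matrix (Fin n) (Fin n) A) ⊗ₖ L) *
      (heckeS n).map (algebraMap Ch A) * ((1 : Matrix (Fin n) (Fin n) A) ⊗ₖ L) =
    ((1 : Matrix (Fin n) (Fin n) A) ⊗ₖ L) * (heckeS n).map (algebraMap Ch A) *
      ((1 : Matrix (Fin n) (Fin n) A) ⊗ₖ L) * (heckeS n).map (algebraMap Ch A)

namespace IsReflectionMatrix

variable {L : Matrix (Fin n) (Fin n) A}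

lemma tower (hL : IsReflectionMatrix L) :
    IsReflectionTower q q⁻¹ (wordUnit Ch A) (matrixOp Ch L) where
  units := isMatrixUnits_wordUnit
  hecke :=
    { qt := q_mul_inv
      quad := heckeOp_wordUnit_quad q_mul_inv
      braid := heckeOp_wordUnit_braid q_mul_inv
      far := fun _ _ hij => isMatrixUnits_wordUnit.commute_heckeOp_heckeOp _ _ hij }
  commutesAt _ hj := commutesAt_matrixOp hj L
  reflection := by
    have := congrArg (pairOp Ch) hL
    simp only [map_mul, pairOp_heckeS, pairOp_one_kronecker] at this
    rw [Commute, SemiconjBy, this]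
    simp only [mul_assoc]

/-- The `q`-traces of the powers of `L` commute with the entries of `L`. -/
lemma commute_qTrace_pow (hL : IsReflectionMatrix L) (m : ℕ) (i j : Fin n) :
    Commute (L i j) (qTrace n (L ^ m)) := by
  have h := hL.tower.commute_partialTrace_pow m
  rw [← map_pow, partialTrace_matrixOp, Commute, SemiconjBy, ← map_mul, ← map_mul] at h
  change matrixOp Ch (L * Matrix.scalar _ (qTrace n (L ^ m))) =
    matrixOp Ch (Matrix.scalar _ (qTrace n (L ^ m)) * L) at h
  generalize qTrace n (L ^ m) = x at h ⊢
  rw [Commute, SemiconjBy]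
  have := congrFun (congrFun (matrixOp_injective h) i) j
  simpa [Matrix.mul_diagonal, Matrix.diagonal_mul] using this

/-- The Cayley-Hamilton identity for matrices satisfying the reflection equation, with coefficients
determined by the Newton identities. -/
lemma cayley_eq_zero (hL : IsReflectionMatrix L) {σ : ℕ → A}
    (hN : ∀ k, qTrace n (L * cayley (fun k => Matrix.scalar (Fin n) (σ k)) L k) =
      qInt qm2 (k + 1) • σ (k + 1)) :
    cayley (fun k => Matrix.scalar (Fin n) (σ k)) L n = 0 := by
  rcases n with _ | k
  · exact Subsingleton.elim _ _
  refine matrixOp_injective (K := Ch) ?_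
  rw [map_zero, map_cayley]
  refine hL.tower.cayley_eq_zero isUnit_qInt (fun k j => commutesAt_matrixOp_scalar j _)
    (fun k => ?_) ?_
  · rw [← map_cayley (matrixOp Ch) (fun k => Matrix.scalar _ (σ k)) L k, ← map_mul,
      partialTrace_matrixOp]
    have := hN k
    rw [qTrace] at this
    change matrixOp Ch (Matrix.scalar _ (∑ i : Fin _, qm2 ^ (i : ℕ) • _)) = qInt qm2 (k + 1) • _
    rw [this]
    ext f w
    rw [LinearMap.smul_apply, Pi.smul_apply, matrixOp_scalar_apply, matrixOp_scalar_apply,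
      smul_mul_assoc]
  · ext1 f
    refine eq_zero_of_heckeOp_eq q_mul_inv isUnit_q_add_inv fun j hj => ?_
    rw [← Module.End.mul_apply, hL.tower.hecke.mul_antisym isUnit_qInt _ _ j (Nat.zero_le _)
      (by omega), LinearMap.smul_apply]

end IsReflectionMatrix

end ReflectionEquation

/-! ### Newton identities for `ϑ` -/

section Vartheta

variable {R : Type*} [CommRing R] {n : ℕ}

lemma esymm_aeval (lam : Fin n → R) (k : ℕ) :
    MvPolynomial.aeval lam (MvPolynomial.esymm (Fin n) R k) =
      ∑ T ∈ Finset.powersetCard k Finset.univ, ∏ j ∈ T, lam j := by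
  simp [MvPolynomial.esymm, map_sum, map_prod]

open PowerSeries in
lemma coeff_prod_one_sub (c : R) (lam : Fin n → R) (k : ℕ) :
    coeff k (∏ j, (1 + -(C (c * lam j) * X))) =
      (-c) ^ k * MvPolynomial.aeval lam (MvPolynomial.esymm (Fin n) R k) := by
  have h : ∀ T : Finset (Fin n), ∏ j ∈ T, -(C (c * lam j) * X : R⟦X⟧) =
      C ((-c) ^ T.card * ∏ j ∈ T, lam j) * X ^ T.card := by
    intro T
    have : ∀ j, -(C (c * lam j) * X : R⟦X⟧) = C (-c * lam j) * X := by
      intro j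
      rw [neg_mul, map_neg, neg_mul]
    rw [Finset.prod_congr rfl fun j _ => this j, Finset.prod_mul_distrib, Finset.prod_const,
      ← map_prod, Finset.prod_mul_distrib, Finset.prod_const]
  rw [Finset.prod_one_add, map_sum, esymm_aeval, Finset.mul_sum]
  simp only [h, coeff_C_mul, coeff_X_pow, mul_ite, mul_one, mul_zero]
  rw [← Finset.sum_filter]
  have : (Finset.univ : Finset (Fin n)).powerset.filter (fun T => k = T.card) =
      Finset.powersetCard k Finset.univ := by
    ext T
    simp [Finset.mem_powersetCard, eq_comm]
  rw [this]
  exact Finset.sum_congr rfl fun T hT => by rw [(Finset.mem_powersetCard.1 hT).2]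

open PowerSeries in
lemma coeff_prod_fin {l : ℕ} (f : Fin l → R⟦X⟧) (m : ℕ) :
    coeff m (∏ a, f a) = ∑ d ∈ Finset.finAntidiagonal l m, ∏ a, coeff (d a) (f a) := by
  rw [coeff_prod]
  refine Finset.sum_bij (fun d _ => ⇑d) (fun d hd => ?_)
    (fun d _ d' _ h => DFunLike.coe_injective h)
    (fun d hd => ⟨Finsupp.equivFunOnFinite.symm d, ?_, rfl⟩) (fun d _ => rfl)
  · simpa [Finset.mem_finsuppAntidiag, Finset.mem_finAntidiagonal] using hd
  · simpa [Finset.mem_finsuppAntidiag, Finset.mem_finAntidiagonal] using hd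

/-- Sums over `l`-element subsets of `Fin n`, as sums over increasing `l`-tuples. -/
lemma sum_powersetCard_eq_sum_increasing {B : Type*} [AddCommMonoid B] {P : Type*} [CommMonoid P]
    (F : P → B) (g : Fin n → P) (l : ℕ) :
    ∑ T ∈ Finset.powersetCard l Finset.univ, F (∏ j ∈ T, g j) =
      ∑ j ∈ (Finset.univ : Finset (Fin l → Fin n)).filter (fun j => ∀ a b, a < b → j a < j b),
        F (∏ a, g (j a)) := by
  symm
  have mono : ∀ {j : Fin l → Fin n}, j ∈ (Finset.univ : Finset (Fin l → Fin n)).filter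
      (fun j => ∀ a b, a < b → j a < j b) → StrictMono j :=
    fun hj a b hab => (Finset.mem_filter.1 hj).2 a b hab
  refine Finset.sum_bij (fun j _ => Finset.univ.image j) (fun j hj => ?_) (fun j hj j' hj' h => ?_)
    (fun T hT => ?_) (fun j hj => ?_)
  · rw [Finset.mem_powersetCard]
    exact ⟨Finset.subset_univ _, by
      rw [Finset.card_image_of_injective _ (mono hj).injective, Finset.card_univ, Fintype.card_fin]⟩
  · refine (StrictMono.range_inj (mono hj) (mono hj')).1 ?_
    simpa using congrArg (fun T : Finset (Fin n) => (T : Set (Fin n))) h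
  · have hc := (Finset.mem_powersetCard.1 hT).2
    refine ⟨T.orderEmbOfFin hc, ?_, ?_⟩
    · rw [Finset.mem_filter]
      exact ⟨Finset.mem_univ _, fun a b hab => (T.orderEmbOfFin hc).strictMono hab⟩
    · simp
  · rw [Finset.prod_image (mono hj).injective.injOn]

open PowerSeries in
/-- The generating function of `ϑ` is `(1 - p)⁻¹ (∏_j (1 + ∑_{d ≥ 1} (1 - p) λ_j^d x^d) - 1)`. -/
lemma one_sub_mul_vartheta (p : R) (lam : Fin n → R) {m : ℕ} (hm : m ≠ 0) :
    (1 - p) * vartheta n p lam m = coeff m (∏ j,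
      (1 + mk fun d => if d = 0 then 0 else (1 - p) * lam j ^ d)) := by
  rw [Finset.prod_one_add, Finset.sum_powerset, Finset.card_univ, Fintype.card_fin, map_sum,
    Finset.sum_range_succ', vartheta, if_neg hm, Finset.mul_sum]
  simp only [Finset.powersetCard_zero, Finset.sum_singleton, Finset.prod_empty, coeff_one,
    if_neg hm, add_zero]
  rw [Finset.range_eq_Ico, Finset.sum_Ico_add' (fun l => coeff m (∑ T ∈ Finset.powersetCard l
    (Finset.univ : Finset (Fin n)), ∏ j ∈ T, mk fun d => if d = 0 then 0 else
      (1 - p) * lam j ^ d)) 0 n 1, zero_add]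
  refine Finset.sum_congr rfl fun l hl => ?_
  obtain ⟨l, rfl⟩ : ∃ k, l = k + 1 := ⟨l - 1, by have := (Finset.mem_Icc.1 hl).1; omega⟩
  rw [map_sum, sum_powersetCard_eq_sum_increasing (coeff (R := R) m), add_tsub_cancel_right,
    ← mul_assoc, ← pow_succ', Finset.sum_comm, Finset.mul_sum]
  refine Finset.sum_congr rfl fun j _ => ?_
  rw [coeff_prod_fin, Finset.mul_sum, Finset.sum_filter]
  refine Finset.sum_congr rfl fun d _ => ?_
  simp only [coeff_mk]
  split_ifs with h
  · rw [Finset.prod_congr rfl fun a _ => if_neg (h a).ne', Finset.prod_mul_distrib,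
      Finset.prod_const, Finset.card_univ, Fintype.card_fin]
  · push Not at h
    obtain ⟨a, ha⟩ := h
    have h0 : d a = 0 := by omega
    rw [Finset.prod_eq_zero (Finset.mem_univ a)]
    exact if_pos h0

open PowerSeries in
lemma one_add_mk_mul (p x : R) :
    (1 + mk fun d => if d = 0 then 0 else (1 - p) * x ^ d) * (1 + -(C (1 * x) * X)) =
      1 + -(C (p * x) * X) := by
  ext d
  rw [mul_add, mul_one, mul_neg, ← mul_assoc, add_mul, one_mul, add_mul]
  rcases d with _ | _ | d
  · simp
  · simp [coeff_one, mul_comm]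
    ring
  · simp [coeff_one, coeff_succ_mul_X]
    ring

/-- The functions `ϑ_m` and the elementary symmetric functions satisfy the quantum Newton
identities. -/
lemma newton_vartheta [IsDomain R] {p : R} (hp : p ≠ 1) (lam : Fin n → R) (m : ℕ) :
    qInt p m * MvPolynomial.aeval lam (MvPolynomial.esymm (Fin n) R m) +
      ∑ i ∈ Finset.Icc 1 m, (-1) ^ i * vartheta n p lam i *
        MvPolynomial.aeval lam (MvPolynomial.esymm (Fin n) R (m - i)) = 0 := by
  set E : ℕ → R := fun k => MvPolynomial.aeval lam (MvPolynomial.esymm (Fin n) R k) with hE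
  have h1 : (∏ j, (1 + PowerSeries.mk fun d => if d = 0 then 0 else (1 - p) * lam j ^ d)) *
      (∏ j, (1 + -(PowerSeries.C (1 * lam j) * PowerSeries.X))) =
      ∏ j, (1 + -(PowerSeries.C (p * lam j) * PowerSeries.X)) := by
    rw [← Finset.prod_mul_distrib]
    exact Finset.prod_congr rfl fun j _ => one_add_mk_mul p (lam j)
  have h2 := congrArg (PowerSeries.coeff m) h1
  rw [PowerSeries.coeff_mul, coeff_prod_one_sub, Finset.Nat.sum_antidiagonal_eq_sum_range_succ_mk,
    Finset.sum_range_succ'] at h2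
  simp only [coeff_prod_one_sub, ← one_sub_mul_vartheta p lam (Nat.succ_ne_zero _)] at h2
  have h0 : PowerSeries.coeff 0 (∏ j, (1 + PowerSeries.mk fun d =>
      if d = 0 then 0 else (1 - p) * lam j ^ d)) = 1 := by
    rw [PowerSeries.coeff_zero_eq_constantCoeff, map_prod]
    refine Finset.prod_eq_one fun j _ => ?_
    rw [← PowerSeries.coeff_zero_eq_constantCoeff, map_add, PowerSeries.coeff_mk]
    simp
  rw [h0, one_mul, Nat.sub_zero] at h2
  refine (mul_eq_zero.1 ?_).resolve_left (sub_ne_zero.2 hp.symm)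
  have h3 : ∑ i ∈ Finset.Icc 1 m, (-1) ^ i * vartheta n p lam i * E (m - i) =
      ∑ i ∈ Finset.range m, (-1) ^ (i + 1) * vartheta n p lam (i + 1) * E (m - (i + 1)) := by
    rw [Finset.range_eq_Ico, Finset.sum_Ico_add' (fun i => (-1) ^ i * vartheta n p lam i *
      E (m - i)) 0 m 1, zero_add]
    rfl
  have h4 : ∑ i ∈ Finset.range m, (1 - p) * vartheta n p lam (i + 1) *
        ((-1) ^ (m - (i + 1)) * E (m - (i + 1))) = (-1) ^ m * ((1 - p) *
      ∑ i ∈ Finset.range m, (-1) ^ (i + 1) * vartheta n p lam (i + 1) * E (m - (i + 1))) := by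
    rw [Finset.mul_sum, Finset.mul_sum]
    refine Finset.sum_congr rfl fun i hi => ?_
    have : (-1 : R) ^ (m - (i + 1)) = (-1) ^ m * (-1) ^ (i + 1) := by
      have e : m = m - (i + 1) + (i + 1) := by have := Finset.mem_range.1 hi; omega
      conv_rhs => rw [e]
      rw [pow_add, mul_assoc, ← mul_pow]
      simp
    rw [this]
    ring
  have h5 : ((-1 : R) ^ m) * (-1) ^ m = 1 := by rw [← mul_pow]; simp
  rw [h4, neg_pow] at h2
  rw [h3, mul_add]
  linear_combination (-1) ^ m * h2 + E m * qInt_mul p m + (-(1 - p) * (∑ i ∈ Finset.range m,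
    (-1) ^ (i + 1) * vartheta n p lam (i + 1) * E (m - (i + 1))) - E m + p ^ m * E m) * h5

/-- The Newton identities determine the power sums, because the coefficient `±e 0` of the last one
is a unit. -/
lemma eq_of_newton {c e f g : ℕ → R} (he : e 0 = 1)
    (hf : ∀ m, 1 ≤ m → c m * e m + ∑ i ∈ Finset.Icc 1 m, (-1) ^ i * f i * e (m - i) = 0)
    (hg : ∀ m, 1 ≤ m → c m * e m + ∑ i ∈ Finset.Icc 1 m, (-1) ^ i * g i * e (m - i) = 0) (m : ℕ)
    (hm : 1 ≤ m) : f m = g m := by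
  induction m using Nat.strong_induction_on with
  | _ m ih =>
    obtain ⟨k, rfl⟩ : ∃ k, m = k + 1 := ⟨m - 1, by omega⟩
    have h1 := hf _ hm
    have h2 := hg _ hm
    rw [Finset.sum_Icc_succ_top (by omega), Nat.sub_self, he] at h1 h2
    have h3 : ∑ i ∈ Finset.Icc 1 k, (-1) ^ i * f i * e (k + 1 - i) =
        ∑ i ∈ Finset.Icc 1 k, (-1) ^ i * g i * e (k + 1 - i) :=
      Finset.sum_congr rfl fun i hi => by
        have := Finset.mem_Icc.1 hi
        rw [ih i (by omega) (by omega)]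
    have h5 : ((-1 : R) ^ (k + 1)) * (-1) ^ (k + 1) = 1 := by rw [← mul_pow]; simp
    linear_combination (-1) ^ (k + 1) * (h1 - h2 - h3) - (f (k + 1) - g (k + 1)) * h5

end Vartheta

/-! ### Elementary symmetric elements and the center -/

noncomputable section

section Newton

variable {n : ℕ}

/-- The solution of the quantum Newton identities for given power sums `s`. It exists because the
quantum integers are invertible in `ℂ[[h]]`. -/
def newtonSeq {A : Type*} [Ring A] [Algebra Ch A] (s : ℕ → A) : ℕ → A
  | 0 => 1
  | m + 1 => (qInt qm2 (m + 1))⁻¹ •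
      ∑ i : Fin (m + 1), (-1) ^ (i : ℕ) * newtonSeq s (m - i) * s (i + 1)

lemma newtonSeq_zero {A : Type*} [Ring A] [Algebra Ch A] (s : ℕ → A) : newtonSeq s 0 = 1 := by
  rw [newtonSeq]

lemma qInt_smul_newtonSeq {A : Type*} [Ring A] [Algebra Ch A] (s : ℕ → A) (m : ℕ) :
    qInt qm2 (m + 1) • newtonSeq s (m + 1) =
      ∑ i ∈ Finset.range (m + 1), (-1) ^ i * newtonSeq s (m - i) * s (i + 1) := by
  have hu : qInt qm2 (m + 1) * (qInt qm2 (m + 1))⁻¹ = 1 :=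
    PowerSeries.mul_inv_cancel _ (PowerSeries.isUnit_iff_constantCoeff.1 (isUnit_qInt m)).ne_zero
  rw [newtonSeq, smul_smul, hu, one_smul, Fin.sum_univ_eq_sum_range (fun i =>
    (-1) ^ i * newtonSeq s (m - i) * s (i + 1))]

lemma commute_newtonSeq {A : Type*} [Ring A] [Algebra Ch A] {s : ℕ → A} {b : A}
    (h : ∀ m, Commute b (s m)) (m : ℕ) : Commute b (newtonSeq s m) := by
  induction m using Nat.strong_induction_on with
  | _ m ih =>
    rcases m with _ | m
    · rw [newtonSeq]
      exact Commute.one_right b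
    · rw [newtonSeq]
      exact (Commute.sum_right _ _ _ fun i _ => (((Commute.neg_one_right b).pow_right _).mul_right
        (ih _ (by omega))).mul_right (h _)).smul_right _

lemma cayley_eq_sum {R : Type*} [Ring R] {σ : ℕ → R} {Y : R} (h0 : σ 0 = 1)
    (hc : ∀ k, Commute Y (σ k)) (k : ℕ) :
    cayley σ Y k = ∑ i ∈ Finset.range (k + 1), (-1) ^ i * (σ (k - i) * Y ^ i) := by
  induction k with
  | zero => simp [cayley, h0]
  | succ k ih =>
    rw [cayley, ih, Finset.sum_range_succ' _ (k + 1), Finset.mul_sum, sub_eq_neg_add,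
      ← Finset.sum_neg_distrib]
    congr 1
    · refine Finset.sum_congr rfl fun i _ => ?_
      have e : Commute Y ((-1) ^ i) := (Commute.neg_one_right Y).pow_right i
      rw [← mul_assoc, e.eq, mul_assoc, ← mul_assoc Y, (hc _).eq, mul_assoc (σ _), ← pow_succ',
        pow_succ (-1), mul_neg_one, neg_mul, Nat.add_sub_add_right]
    · simp

variable {A : Type*} [Ring A] [Algebra Ch A]

lemma qTrace_sum {ι : Type*} (s : Finset ι) (f : ι → Matrix (Fin n) (Fin n) A) :
    qTrace n (∑ i ∈ s, f i) = ∑ i ∈ s, qTrace n (f i) := by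
  simp only [qTrace, Matrix.sum_apply, Finset.smul_sum]
  exact Finset.sum_comm

lemma qTrace_scalar_mul (x : A) (M : Matrix (Fin n) (Fin n) A) :
    qTrace n (Matrix.scalar (Fin n) x * M) = x * qTrace n M := by
  simp [qTrace, Finset.mul_sum]

/-- The elementary symmetric elements of a matrix `L`, defined from the `q`-traces of its powers
through the Newton identities. -/
def elemSym (L : Matrix (Fin n) (Fin n) A) (k : ℕ) : A := newtonSeq (fun m => qTrace n (L ^ m)) k

/-- The elementary symmetric elements of a matrix, as scalar matrices. -/
def elemMatrix (L : Matrix (Fin n) (Fin n) A) (k : ℕ) : Matrix (Fin n) (Fin n) A :=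
  Matrix.scalar (Fin n) (elemSym L k)

lemma qInt_smul_elemSym_add (L : Matrix (Fin n) (Fin n) A)
    (hc : ∀ m b, Commute b (qTrace n (L ^ m))) (m : ℕ) (hm : 1 ≤ m) :
    qInt qm2 m • elemSym L m +
      ∑ i ∈ Finset.Icc 1 m, (-1) ^ i * qTrace n (L ^ i) * elemSym L (m - i) = 0 := by
  obtain ⟨m, rfl⟩ : ∃ k, m = k + 1 := ⟨m - 1, by omega⟩
  have h := Finset.sum_Ico_add' (fun i => (-1) ^ i * qTrace n (L ^ i) * elemSym L (m + 1 - i))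
    0 (m + 1) 1
  rw [zero_add] at h
  rw [elemSym, qInt_smul_newtonSeq]
  change _ + ∑ i ∈ Finset.Ico 1 (m + 1 + 1), _ = _
  rw [← h, ← Finset.range_eq_Ico, ← Finset.sum_add_distrib]
  refine Finset.sum_eq_zero fun i _ => ?_
  rw [mul_assoc ((-1) ^ i), (hc (i + 1) _).eq, pow_succ (-1), Nat.add_sub_add_right, elemSym]
  noncomm_ring

/-- The Newton identities with the signs as scalars of `ℂ[[h]]`, a form that makes sense in the
semiring underlying the center. -/
lemma smul_elemSym_add_sum_smul (L : Matrix (Fin n) (Fin n) A)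
    (hc : ∀ m b, Commute b (qTrace n (L ^ m))) (m : ℕ) (hm : 1 ≤ m) :
    qInt qm2 m • elemSym L m +
      ∑ i ∈ Finset.Icc 1 m, ((-1) ^ i : Ch) • (qTrace n (L ^ i) * elemSym L (m - i)) = 0 := by
  rw [← qInt_smul_elemSym_add L hc m hm]
  congr 1
  refine Finset.sum_congr rfl fun i _ => ?_
  rw [Algebra.smul_def, map_pow, map_neg, map_one, mul_assoc]

variable {L : Matrix (Fin n) (Fin n) A} (hL : IsReflectionMatrix L)
  (hc : ∀ m b, Commute b (qTrace n (L ^ m)))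

include hc

lemma commute_elemSym (m : ℕ) (b : A) : Commute b (elemSym L m) :=
  commute_newtonSeq (fun m => hc m b) m

lemma commute_elemMatrix (k : ℕ) (M : Matrix (Fin n) (Fin n) A) : Commute M (elemMatrix L k) :=
  (Matrix.scalar_commute _ (fun r => (commute_elemSym hc k r).symm) M).symm

lemma cayley_elemMatrix (k : ℕ) : cayley (elemMatrix L) L k =
    ∑ i ∈ Finset.range (k + 1), (-1) ^ i * (elemMatrix L (k - i) * L ^ i) :=
  cayley_eq_sum (by rw [elemMatrix, elemSym, newtonSeq_zero, map_one])
    (fun k => commute_elemMatrix hc k _) k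

lemma qTrace_mul_cayley (k : ℕ) : qTrace n (L * cayley (elemMatrix L) L k) =
    qInt qm2 (k + 1) • elemSym L (k + 1) := by
  have h : ∀ i, L * ((-1) ^ i * (elemMatrix L (k - i) * L ^ i)) =
      Matrix.scalar (Fin n) ((-1) ^ i * elemSym L (k - i)) * L ^ (i + 1) := by
    intro i
    have e : Commute L ((-1) ^ i) := (Commute.neg_one_right L).pow_right i
    rw [← mul_assoc, e.eq, mul_assoc, ← mul_assoc L, (commute_elemMatrix hc _ _).eq,
      mul_assoc (elemMatrix _ _), ← pow_succ', ← mul_assoc, map_mul, map_pow, map_neg, map_one]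
    rfl
  rw [cayley_elemMatrix hc, Finset.mul_sum, Finset.sum_congr rfl fun i _ => h i, qTrace_sum]
  simp only [qTrace_scalar_mul]
  exact (qInt_smul_newtonSeq _ k).symm

include hL

lemma cayley_elemMatrix_eq_zero {m : ℕ} (hm : n ≤ m) :
    cayley (elemMatrix L) L m = 0 ∧ elemSym L (m + 1) = 0 := by
  have step : ∀ m, cayley (elemMatrix L) L m = 0 → elemSym L (m + 1) = 0 := by
    intro m h
    have := qTrace_mul_cayley hc m
    rw [h, mul_zero] at this
    have h0 : qTrace n (0 : Matrix (Fin n) (Fin n) A) = 0 := by simp [qTrace]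
    rw [h0] at this
    exact (isUnit_qInt m).smul_eq_zero.1 this.symm
  induction m, hm using Nat.le_induction with
  | base =>
    have := hL.cayley_eq_zero (qTrace_mul_cayley hc)
    exact ⟨this, step n this⟩
  | succ m _ ih =>
    have : cayley (elemMatrix L) L (m + 1) = 0 := by
      rw [cayley, ih.1, mul_zero, sub_zero, elemMatrix, ih.2, map_zero]
    exact ⟨this, step _ this⟩

lemma sum_elemSym_smul_pow_eq_zero :
    ∑ i ∈ Finset.range (n + 1), ((-1) ^ i * elemSym L i) • L ^ (n - i) = 0 := by
  have h := (cayley_elemMatrix_eq_zero hL hc le_rfl).1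
  rw [cayley_elemMatrix hc, ← Finset.sum_range_reflect] at h
  have h2 : ∀ i ∈ Finset.range (n + 1), ((-1) ^ i * elemSym L i) • L ^ (n - i) =
      (-1) ^ n * ((-1) ^ (n + 1 - 1 - i) * (elemMatrix L (n - (n + 1 - 1 - i)) *
        L ^ (n + 1 - 1 - i))) := by
    intro i hi
    have hi' : i ≤ n := Nat.lt_succ_iff.1 (Finset.mem_range.1 hi)
    rw [Nat.add_sub_cancel, Nat.sub_sub_self hi', ← mul_assoc, ← pow_add,
      show n + (n - i) = i + 2 * (n - i) by omega, pow_add, pow_mul, neg_one_sq, one_pow, mul_one,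
      elemMatrix, ← mul_assoc, Matrix.smul_eq_diagonal_mul]
    congr 1
    have : (-1 : Matrix (Fin n) (Fin n) A) ^ i = Matrix.scalar (Fin n) ((-1) ^ i) := by
      rw [map_pow, map_neg, map_one]
    rw [this, ← map_mul]
    rfl
  rw [Finset.sum_congr rfl h2, ← Finset.mul_sum, h, mul_zero]

end Newton

section Center

variable (n : ℕ)

lemma isReflectionMatrix_L : IsReflectionMatrix (L n) := by
  set φ := RingQuot.mkAlgHom Ch (Rel n)
  have h1 : (freeS n).map φ = (heckeS n).map (algebraMap Ch (RE n)) := by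
    ext r c
    simp only [freeS, Matrix.map_apply]
    exact φ.commutes _
  have h2 : (freeL₂ n).map φ = (1 : Matrix (Fin n) (Fin n) (RE n)) ⊗ₖ L n := by
    ext r c
    simp only [freeL₂, L, Matrix.map_apply, Matrix.kroneckerMap_apply, map_mul, Matrix.one_apply,
      apply_ite φ, map_one, map_zero]
    rfl
  rw [IsReflectionMatrix, ← h1, ← h2]
  simp only [← Matrix.map_mul]
  ext r c
  exact RingQuot.mkAlgHom_rel Ch (Rel.entry r c)

variable {n}

/-- Elements commuting with the generators are central. -/
lemma mem_Inv_of_commute {x : RE n} (hx : ∀ i j, Commute (L n i j) x) : x ∈ Inv n := by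
  rw [Subalgebra.mem_center_iff]
  intro b
  obtain ⟨b, rfl⟩ := RingQuot.mkAlgHom_surjective Ch (Rel n) b
  change Commute _ x
  induction b using FreeAlgebra.induction with
  | grade0 r =>
    rw [AlgHom.commutes]
    exact Algebra.commute_algebraMap_left _ _
  | grade1 v => exact hx v.1 v.2
  | mul a b ha hb =>
    rw [map_mul]
    exact ha.mul_left hb
  | add a b ha hb =>
    rw [map_add]
    exact ha.add_left hb

lemma commute_qTrace_L_pow (m : ℕ) (b : RE n) : Commute b (qTrace n (L n ^ m)) :=
  Subalgebra.mem_center_iff.1 (mem_Inv_of_commute fun i j =>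
    (isReflectionMatrix_L n).commute_qTrace_pow m i j) b

end Center

lemma qm2_ne_one : qm2 ≠ 1 := by
  intro h
  have h1 : q = q⁻¹ := by
    have := q_mul_qm2
    rwa [h, mul_one] at this
  have h2 : q * q = 1 := by
    have := q_mul_inv
    rwa [← h1] at this
  have := congrArg (PowerSeries.coeff 1) h2
  simp [PowerSeries.coeff_mul, q, Finset.Nat.antidiagonal_succ, PowerSeries.coeff_one] at this

end

end REAlg

open REAlg in
theorem proposition5 (n : ℕ) :
    ∃ s σ : ℕ → Inv n,
      -- the q-traces of the powers of `L` are invariants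
      (∀ m : ℕ, (s m : RE n) = qTrace n (L n ^ m)) ∧
      -- the `σ`'s are invariants, namely the coefficients in the Cayley-Hamilton identity
      σ 0 = 1 ∧ (∀ m : ℕ, n < m → σ m = 0) ∧
      ∑ i ∈ Finset.range (n + 1), ((-1) ^ i * (σ i : RE n)) • L n ^ (n - i) = 0 ∧
      -- the quantum Newton identities
      (∀ m : ℕ, 1 ≤ m →
        qInt qm2 m • (σ m : RE n) +
          ∑ i ∈ Finset.Icc 1 m, (-1) ^ i * (s i : RE n) * (σ (m - i) : RE n) = 0) ∧
      -- the values of the character with `σ_m ↦ σ_m(λ)`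
      ∀ (lam : Fin n → Ch) (χ : Inv n →ₐ[Ch] Ch),
        (∀ m : ℕ, 1 ≤ m → m ≤ n →
          χ (σ m) = MvPolynomial.aeval lam (MvPolynomial.esymm (Fin n) Ch m)) →
        ∀ m : ℕ, χ (s m) = vartheta n qm2 lam m := by
  have hL := isReflectionMatrix_L n
  have hc := commute_qTrace_L_pow (n := n)
  have mem {x : RE n} (hx : ∀ b, Commute b x) : x ∈ Inv n := Subalgebra.mem_center_iff.2 hx
  refine ⟨fun m => ⟨qTrace n (L n ^ m), mem (hc m)⟩,
    fun m => ⟨elemSym (L n) m, mem (commute_elemSym hc m)⟩, fun m => rfl,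
    Subtype.ext (newtonSeq_zero _), fun m hm => ?_, sum_elemSym_smul_pow_eq_zero hL hc,
    qInt_smul_elemSym_add (L n) hc, fun lam χ hχ m => ?_⟩
  · obtain ⟨k, rfl⟩ : ∃ k, m = k + 1 := ⟨m - 1, by omega⟩
    exact Subtype.ext (cayley_elemMatrix_eq_zero hL hc (Nat.lt_succ_iff.1 hm)).2
  set s : ℕ → Inv n := fun m => ⟨qTrace n (L n ^ m), mem (hc m)⟩ with hs
  set σ : ℕ → Inv n := fun m => ⟨elemSym (L n) m, mem (commute_elemSym hc m)⟩ with hσ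
  have hσ0 : σ 0 = 1 := Subtype.ext (newtonSeq_zero _)
  have hE : ∀ m, χ (σ m) = MvPolynomial.aeval lam (MvPolynomial.esymm (Fin n) Ch m) := by
    intro m
    rcases Nat.eq_zero_or_pos m with rfl | hm
    · rw [hσ0, map_one, MvPolynomial.esymm_zero, map_one]
    rcases le_or_gt m n with h | h
    · exact hχ m hm h
    · obtain ⟨k, rfl⟩ : ∃ k, m = k + 1 := ⟨m - 1, by omega⟩
      have : σ (k + 1) = 0 :=
        Subtype.ext (cayley_elemMatrix_eq_zero hL hc (Nat.lt_succ_iff.1 h)).2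
      rw [this, map_zero, esymm_aeval, Finset.powersetCard_eq_empty.2 (by simpa using h),
        Finset.sum_empty]
  rcases Nat.eq_zero_or_pos m with rfl | hm
  · have : s 0 = algebraMap Ch (Inv n) (qInt qm2 n) := by
      refine Subtype.ext ?_
      change qTrace n (L n ^ 0) = algebraMap Ch (RE n) (qInt qm2 n)
      rw [pow_zero, qTrace, qInt, map_sum, ← Fin.sum_univ_eq_sum_range (fun i =>
        algebraMap Ch (RE n) (qm2 ^ i))]
      refine Finset.sum_congr rfl fun i _ => ?_
      rw [Matrix.one_apply_eq, Algebra.algebraMap_eq_smul_one]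
    rw [this, AlgHom.commutes, vartheta, if_pos rfl]
    rfl
  refine eq_of_newton (c := qInt qm2) (e := fun m => χ (σ m)) (f := fun m => χ (s m))
    (g := vartheta n qm2 lam) (by rw [hσ0, map_one]) (fun m hm => ?_) (fun m hm => ?_) m hm
  · have h1 : qInt qm2 m • σ m + ∑ i ∈ Finset.Icc 1 m, ((-1 : Ch) ^ i) • (s i * σ (m - i)) = 0 := by
      have hinj : Function.Injective (Inv n).val := Subtype.val_injective
      refine hinj ?_
      rw [map_add, map_sum]
      simp only [map_smul, map_mul, map_zero]
      exact smul_elemSym_add_sum_smul (L n) hc m hm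
    have h2 := congrArg χ h1
    simpa only [map_add, map_sum, map_smul, map_mul, map_zero, smul_eq_mul, ← mul_assoc] using h2
  · simp only [hE]
    exact newton_vartheta qm2_ne_one lam m
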